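/- Let $n\ge 2$, let $\mathbb{B}^n$ be the open unit ball of $\mathbb{R}^n$, and let $e_1,e_2$ be the first two vectors of the standard basis of $\mathbb{R}^n$. For $x\in\mathbb{B}^n$ and a unit vector $l\in\mathbb{R}^n$, let $C(x,l)$ denote the sharp constant in $$|\langle\nabla u(x),l\rangle|\le C(x,l)\,\sup_{|y|<1}|u(y)|,$$ that is, the least real number for which this inequality holds for all bounded harmonic functions $u:\mathbb{B}^n\to\mathbb{R}$. Then for every $0\le\rho<1$, every $\alpha\in\mathbb{R}$ and $l=\cos\alpha\, e_1+\sin\alpha\, e_2$, $$C(\rho e_1,l)=\frac{n}{1-\rho^2}\,\frac{\Gamma(\frac n2)}{\Gamma(\frac12)\Gamma(\frac{n-1}2)}\int_{-1}^{1}\Bigl|\tfrac{n-2}{n}\rho\cos\alpha-x\Bigr|\,\frac{(1-x^2)^{\frac{n-3}{2}}}{(1+\rho^2-2\rho x\cos\alpha)^{\frac n2-1}}\;{}_2F_1\Bigl(\tfrac{n-2}{4},\tfrac n4;\tfrac{n-1}{2};\tfrac{4\rho^2\sin^2\alpha\,(1-x^2)}{(1+\rho^2-2\rho x\cos\alpha)^2}\Bigr)\,dx,$$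 where ${}_2F_1$ is the Gauss hypergeometric function. -/

import Mathlib

open scoped RealInnerProductSpace Gradient

/-- The admissible constants in the estimate of the derivative at the point `x` in the direction
`l` of bounded harmonic functions on the open unit ball of `ℝⁿ`: all real `C` such that
`|⟨∇u(x), l⟩| ≤ C * sup_{|y| < 1} |u(y)|` for every real-valued bounded harmonic function `u` on
the ball. (Only the values of `u` on the ball matter.) -/
def admissibleConstants {n : ℕ} (x l : EuclideanSpace ℝ (Fin n)) : Set ℝ :=
  {C : ℝ | ∀ u : EuclideanSpace ℝ (Fin n) → ℝ,
    InnerProductSpace.HarmonicOnNhd u (Metric.ball 0 1) →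
    BddAbove ((fun y => |u y|) '' Metric.ball 0 1) →
    |⟪∇ u x, l⟫| ≤ C * sSup ((fun y => |u y|) '' Metric.ball 0 1)}

/-- `K` is the sharp (best) constant `C(x, l)`: the least admissible constant. -/
def IsSharpConstant {n : ℕ} (x l : EuclideanSpace ℝ (Fin n)) (K : ℝ) : Prop :=
  IsLeast (admissibleConstants x l) K

/-! By duality the sharp constant is an `L¹` norm. A function harmonic in the ball and continuous up
to the sphere is the Poisson integral of its boundary values. So its derivative at `x` along `l` is
the mean over the sphere of those values against `∂_l P(x, ζ)`, and is at most `sup |u|` times the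
mean of `|∂_l P(x, ·)|`. Dilations `u (r • ·)` with `r → 1` carry the bound to all bounded harmonic
functions, and the Poisson integral of the sign of `∂_l P(x, ·)` attains it
(`isSharpConstant_poissonKernelBall`).

The mean is then evaluated. Let `ζ*` be the second point where the line through `x` and `ζ` meets
the sphere. The involution `ζ ↦ ζ*` has Jacobian `κ ^ (n - 1)`, `κ = (1 - ‖x‖²) / ‖x - ζ‖²`
(`lintegral_sphere_chordReflection`), and `‖x - ζ*‖ = (1 - ‖x‖²) / ‖x - ζ‖`. Substituting it turns
the kernel into `n / (1 - ‖x‖²) * |(n - 2) / n * ⟪x, l⟫ - ⟪ζ, l⟫| * ‖x - ζ‖ ^ (2 - n)`, whose first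
variable factor depends on `ζ` only through `⟪ζ, l⟫`.

Finally the sphere is sliced orthogonally to `l`. On the slice `⟪ζ, l⟫ = t` the quantity `‖x - ζ‖²`
is affine in one coordinate of a sphere of dimension one less. The binomial series and the even
moments of a coordinate give the slice average as a `₂F₁` (`lintegral_sphere_rpow_neg`). The
quotient of Gamma values is the ratio of the two sphere areas. -/

open MeasureTheory Set Module

/-! ### Surface measure: polar coordinates, slicing, moments of a coordinate. -/

section SphereIntegration

open scoped ENNReal

variable {E : Type*} [NormedAddCommGroup E] [InnerProductSpace ℝ E] [FiniteDimensional ℝ E]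
  [MeasurableSpace E] [BorelSpace E]

/-- Surface measure on the unit sphere of a Euclidean space. -/
noncomputable abbrev surfaceMeasure (E : Type*) [NormedAddCommGroup E] [InnerProductSpace ℝ E]
    [FiniteDimensional ℝ E] [MeasurableSpace E] [BorelSpace E] :
    Measure (Metric.sphere (0 : E) 1) :=
  (volume : Measure E).toSphere

/-- Integration in polar coordinates. -/
theorem lintegral_eq_lintegral_sphere [Nontrivial E] {f : E → ℝ≥0∞} (hf : Measurable f) :
    ∫⁻ y, f y = ∫⁻ ζ, (∫⁻ r in Ioi (0 : ℝ),
      ENNReal.ofReal (r ^ (finrank ℝ E - 1)) * f (r • (ζ : E))) ∂surfaceMeasure E := by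
  have h := (volume : Measure E).measurePreserving_homeomorphUnitSphereProd
  have h1 : ∫⁻ y, f y = ∫⁻ y : ({(0)}ᶜ : Set E), f y ∂((volume : Measure E).comap (↑)) := by
    rw [lintegral_subtype_comap (measurableSet_singleton _).compl, restrict_compl_singleton]
  have h2 : ∫⁻ y : ({(0)}ᶜ : Set E), f y ∂((volume : Measure E).comap (↑)) =
      ∫⁻ p, f ((p.2 : ℝ) • (p.1 : E)) ∂((surfaceMeasure E).prod
        (Measure.volumeIoiPow (finrank ℝ E - 1))) := by
    rw [← h.lintegral_comp (by fun_prop)]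
    refine lintegral_congr fun y => ?_
    have : ‖(y : E)‖ ≠ 0 := norm_ne_zero_iff.2 y.2
    simp [smul_smul, this]
  rw [h1, h2, lintegral_prod _ (by fun_prop)]
  refine lintegral_congr fun ζ => ?_
  rw [Measure.volumeIoiPow, lintegral_withDensity_eq_lintegral_mul _ (by fun_prop) (by fun_prop),
    ← lintegral_subtype_comap measurableSet_Ioi]
  rfl

/-- Trades a sphere integral for an integral over the whole space, where Fubini and linear
isometries apply. With a Gaussian weight the radial factor is finite and positive, so it can be
cancelled. -/
theorem lintegral_sphere_radial_weight [Nontrivial E] {f : E → ℝ≥0∞} (hf : Measurable f)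
    {w : ℝ → ℝ≥0∞} (hw : Measurable w) (hfw : ∀ (r : ℝ) (y : E), 0 < r → f (r • y) = f y) :
    ∫⁻ y, f y * w ‖y‖ = (∫⁻ r in Ioi (0 : ℝ), ENNReal.ofReal (r ^ (finrank ℝ E - 1)) * w r) *
      ∫⁻ ζ, f ζ ∂surfaceMeasure E := by
  rw [lintegral_eq_lintegral_sphere (by fun_prop), ← lintegral_const_mul _ (by fun_prop)]
  refine lintegral_congr fun ζ => ?_
  rw [← lintegral_mul_const _ (by fun_prop)]
  refine setLIntegral_congr_fun measurableSet_Ioi fun r hr => ?_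
  have hr : 0 < r := hr
  simp only [hfw r _ hr, norm_smul, Real.norm_eq_abs, abs_of_pos hr, norm_eq_of_mem_sphere, mul_one]
  ring

/-- Orthogonal splitting along a unit vector, as an isometry from the `L²` product. -/
theorem measurePreserving_smul_add_orthogonal {l : E} (hl : ‖l‖ = 1) :
    MeasurePreserving (fun p : ℝ × (ℝ ∙ l)ᗮ => p.1 • l + (p.2 : E)) := by
  let e : WithLp 2 (ℝ × (ℝ ∙ l)ᗮ) →ₗᵢ[ℝ] E :=
    { toFun := fun p => p.fst • l + (p.snd : E)
      map_add' := fun p q => by simp [add_smul]; abel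
      map_smul' := fun c p => by simp [mul_smul]
      norm_map' := fun p => by
        have h : ⟪l, (p.snd : E)⟫ = 0 := Submodule.mem_orthogonal_singleton_iff_inner_right.1 p.snd.2
        rw [← sq_eq_sq₀ (norm_nonneg _) (norm_nonneg _), WithLp.prod_norm_sq_eq_of_L2]
        change ‖p.fst • l + (p.snd : E)‖ ^ 2 = _
        rw [norm_add_sq_real, inner_smul_left, h, norm_smul, hl]
        simp }
  have hl0 : l ≠ 0 := by rintro rfl; simp at hl
  have hpos : 0 < finrank ℝ E := by
    have : Nontrivial E := ⟨l, 0, hl0⟩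
    exact finrank_pos
  have hd : finrank ℝ (WithLp 2 (ℝ × (ℝ ∙ l)ᗮ)) = finrank ℝ E := by
    have h1 : finrank ℝ (WithLp 2 (ℝ × (ℝ ∙ l)ᗮ)) = finrank ℝ (ℝ × (ℝ ∙ l)ᗮ) :=
      (WithLp.linearEquiv 2 ℝ (ℝ × (ℝ ∙ l)ᗮ)).finrank_eq
    have h2 := (ℝ ∙ l).finrank_add_finrank_orthogonal
    rw [finrank_span_singleton hl0] at h2
    rw [h1, finrank_prod, finrank_self, h2]
  exact (LinearIsometryEquiv.measurePreserving (e.toLinearIsometryEquiv hd)).comp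
    (WithLp.volume_preserving_toLp ℝ (ℝ ∙ l)ᗮ)

omit [FiniteDimensional ℝ E] [MeasurableSpace E] [BorelSpace E] in
theorem norm_smul_add_orthogonal_sq {l : E} (hl : ‖l‖ = 1) (t : ℝ) (z : (ℝ ∙ l)ᗮ) :
    ‖t • l + (z : E)‖ ^ 2 = t ^ 2 + ‖z‖ ^ 2 := by
  have h : ⟪l, (z : E)⟫ = 0 := Submodule.mem_orthogonal_singleton_iff_inner_right.1 z.2
  rw [norm_add_sq_real, inner_smul_left, h, norm_smul, hl]
  simp

theorem lintegral_eq_lintegral_orthogonal {l : E} (hl : ‖l‖ = 1) {f : E → ℝ≥0∞}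
    (hf : Measurable f) : ∫⁻ y, f y = ∫⁻ z : (ℝ ∙ l)ᗮ, ∫⁻ t : ℝ, f (t • l + (z : E)) := by
  rw [← (measurePreserving_smul_add_orthogonal hl).lintegral_comp hf,
    Measure.volume_eq_prod, lintegral_prod_symm _ (by fun_prop)]

theorem lintegral_pow_mul_exp_neg_sq (k : ℕ) :
    ∫⁻ r in Ioi (0 : ℝ), ENNReal.ofReal (r ^ k) * ENNReal.ofReal (Real.exp (-r ^ 2)) =
      ENNReal.ofReal (Real.Gamma ((k + 1) / 2) / 2) := by
  have h := integral_rpow_mul_exp_neg_rpow (p := 2) (q := k) (by norm_num)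
    (by have : (0 : ℝ) ≤ k := by positivity
        linarith)
  have hi := integrableOn_rpow_mul_exp_neg_rpow (p := 2) (s := k)
    (by have : (0 : ℝ) ≤ k := by positivity
        linarith) (by norm_num)
  simp only [Real.rpow_natCast, Real.rpow_ofNat] at h hi
  rw [show Real.Gamma ((k + 1) / 2) / 2 = (1 / 2 : ℝ) * Real.Gamma ((k + 1) / 2) by ring, ← h,
    ofReal_integral_eq_lintegral_ofReal hi]
  · refine setLIntegral_congr_fun measurableSet_Ioi fun r hr => ?_
    have hr : 0 < r := hr
    rw [ENNReal.ofReal_mul (by positivity)]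
  · filter_upwards [ae_restrict_mem measurableSet_Ioi] with r hr
    have hr : 0 < r := hr
    simp only [Pi.zero_apply]
    positivity

theorem lintegral_upper_half_plane {G : ℝ × ℝ → ℝ≥0∞} (hG : Measurable G) :
    ∫⁻ r in Ioi (0 : ℝ), ∫⁻ t : ℝ, G (t, r) = ∫⁻ p in Ioi (0 : ℝ) ×ˢ Ioo (0 : ℝ) Real.pi,
      ENNReal.ofReal p.1 * G (p.1 * Real.cos p.2, p.1 * Real.sin p.2) := by
  have hS : MeasurableSet {p : ℝ × ℝ | 0 < p.2} := measurableSet_lt measurable_const measurable_snd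
  have h1 : ∫⁻ r in Ioi (0 : ℝ), ∫⁻ t : ℝ, G (t, r) = ∫⁻ p, {p : ℝ × ℝ | 0 < p.2}.indicator G p := by
    rw [Measure.volume_eq_prod, lintegral_prod_symm _ (hG.indicator hS).aemeasurable,
      ← lintegral_indicator measurableSet_Ioi]
    refine lintegral_congr fun r => ?_
    by_cases hr : 0 < r <;> simp [indicator, hr]
  rw [h1, ← lintegral_comp_polarCoord_symm]
  have hT : Ioi (0 : ℝ) ×ˢ Ioo (0 : ℝ) Real.pi ⊆ polarCoord.target :=
    prod_mono_right (Ioo_subset_Ioo_left (by linarith [Real.pi_pos]))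
  rw [← inter_eq_right.2 hT, inter_comm, ← Measure.restrict_restrict
    (measurableSet_Ioi.prod measurableSet_Ioo),
    ← lintegral_indicator (measurableSet_Ioi.prod measurableSet_Ioo)]
  refine setLIntegral_congr_fun polarCoord.open_target.measurableSet ?_
  rintro ⟨R, φ⟩ ⟨hR, hφ⟩
  replace hR : 0 < R := hR
  by_cases hφ0 : 0 < φ
  · have hs : 0 < Real.sin φ := Real.sin_pos_of_pos_of_lt_pi hφ0 hφ.2
    simp [indicator, hR, hφ0, hs, hφ.2]
  · have hs : Real.sin φ ≤ 0 :=
      Real.sin_nonpos_of_nonpos_of_neg_pi_le (not_lt.1 hφ0) hφ.1.le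
    have : ¬ 0 < R * Real.sin φ := not_lt.2 (mul_nonpos_of_nonneg_of_nonpos hR.le hs)
    simp [indicator, hφ0, this]

/-- Integration over the unit sphere by slices orthogonal to `l`. -/
theorem lintegral_sphere_eq_lintegral_slices {l : E} (hl : ‖l‖ = 1) (hE : 2 ≤ finrank ℝ E)
    {f : E → ℝ≥0∞} (hf : Measurable f) :
    ∫⁻ ζ, f ζ ∂surfaceMeasure E = ∫⁻ ω, (∫⁻ φ in Ioo (0 : ℝ) Real.pi,
      ENNReal.ofReal (Real.sin φ ^ (finrank ℝ E - 2)) *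
        f (Real.cos φ • l + Real.sin φ • (ω : (ℝ ∙ l)ᗮ))) ∂surfaceMeasure (ℝ ∙ l)ᗮ := by
  have hl0 : l ≠ 0 := by rintro rfl; simp at hl
  have : Nontrivial E := ⟨l, 0, hl0⟩
  have hd : finrank ℝ (ℝ ∙ l)ᗮ = finrank ℝ E - 1 := by
    have h2 := (ℝ ∙ l).finrank_add_finrank_orthogonal
    rw [finrank_span_singleton hl0] at h2
    omega
  have : Nontrivial (ℝ ∙ l)ᗮ := Module.nontrivial_of_finrank_pos (R := ℝ) (by omega)
  obtain ⟨m, hm⟩ : ∃ m, finrank ℝ E = m + 2 := ⟨_, (Nat.sub_add_cancel hE).symm⟩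
  rw [hm] at hd
  simp only [hm, Nat.add_sub_cancel]
  -- The weight is auxiliary: the degree-zero extension `g` of `f`, times `w`, is integrated over
  -- `E` in two ways. Polar coordinates in `E` give the left side; the splitting along `l`, with
  -- polar coordinates in `lᗮ` and then in the half-plane `(t, r)`, gives the right side. The same
  -- constant `c` appears in both and cancels.
  set w : ℝ → ℝ≥0∞ := fun r => ENNReal.ofReal (Real.exp (-r ^ 2)) with hwdef
  have hw : Measurable w := by fun_prop
  set c : ℝ≥0∞ := ∫⁻ r in Ioi (0 : ℝ), ENNReal.ofReal (r ^ (m + 1)) * w r with hc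
  set g : E → ℝ≥0∞ := fun y => f (‖y‖⁻¹ • y) with hg
  have hgm : Measurable g := by fun_prop
  have hghom : ∀ (r : ℝ) (y : E), 0 < r → g (r • y) = g y := by
    intro r y hr
    simp only [hg, norm_smul, Real.norm_eq_abs, abs_of_pos hr, smul_smul, mul_inv]
    congr 2
    field_simp
  have hc0 : c ≠ 0 := by
    rw [hc, lintegral_pow_mul_exp_neg_sq]
    simpa using Real.Gamma_pos_of_pos (by positivity)
  have hctop : c ≠ ∞ := by
    rw [hc, lintegral_pow_mul_exp_neg_sq]
    exact ENNReal.ofReal_ne_top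
  have hleft : ∫⁻ y, g y * w ‖y‖ = c * ∫⁻ ζ, f ζ ∂surfaceMeasure E := by
    rw [lintegral_sphere_radial_weight hgm hw hghom, hm]
    simp [hg, hc]
  have hinner : ∀ ω : Metric.sphere (0 : (ℝ ∙ l)ᗮ) 1,
      ∫⁻ r in Ioi (0 : ℝ), ∫⁻ t : ℝ, ENNReal.ofReal (r ^ m) *
        (g (t • l + r • ((ω : (ℝ ∙ l)ᗮ) : E)) * w ‖t • l + r • ((ω : (ℝ ∙ l)ᗮ) : E)‖) =
      c * ∫⁻ φ in Ioo (0 : ℝ) Real.pi, ENNReal.ofReal (Real.sin φ ^ m) *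
        f (Real.cos φ • l + Real.sin φ • ((ω : (ℝ ∙ l)ᗮ) : E)) := by
    intro ω
    set z : E := ((ω : (ℝ ∙ l)ᗮ) : E) with hz
    have hnorm : ∀ t r : ℝ, ‖t • l + r • z‖ ^ 2 = t ^ 2 + r ^ 2 := by
      intro t r
      have := norm_smul_add_orthogonal_sq hl t (r • (ω : (ℝ ∙ l)ᗮ))
      simpa [norm_smul] using this
    have hpt : ∀ p ∈ Ioi (0 : ℝ) ×ˢ Ioo (0 : ℝ) Real.pi, ENNReal.ofReal p.1 *
        (ENNReal.ofReal ((p.1 * Real.sin p.2) ^ m) *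
          (g ((p.1 * Real.cos p.2) • l + (p.1 * Real.sin p.2) • z) *
            w ‖(p.1 * Real.cos p.2) • l + (p.1 * Real.sin p.2) • z‖)) =
        (ENNReal.ofReal (p.1 ^ (m + 1)) * w p.1) *
          (ENNReal.ofReal (Real.sin p.2 ^ m) * f (Real.cos p.2 • l + Real.sin p.2 • z)) := by
      rintro ⟨R, φ⟩ ⟨hR, hφ⟩
      replace hR : 0 < R := hR
      have hs : 0 < Real.sin φ := Real.sin_pos_of_pos_of_lt_pi hφ.1 hφ.2
      have hv : (R * Real.cos φ) • l + (R * Real.sin φ) • z =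
          R • (Real.cos φ • l + Real.sin φ • z) := by
        rw [smul_add, smul_smul, smul_smul]
      have hn1 : ‖Real.cos φ • l + Real.sin φ • z‖ = 1 := by
        rw [← sq_eq_sq₀ (norm_nonneg _) zero_le_one, hnorm]
        simp
      have hgv : g (Real.cos φ • l + Real.sin φ • z) = f (Real.cos φ • l + Real.sin φ • z) := by
        simp [hg, hn1]
      simp only
      rw [hv, hghom _ _ hR, norm_smul, hn1, mul_pow, ENNReal.ofReal_mul (by positivity),
        pow_succ, ENNReal.ofReal_mul (by positivity), hgv, mul_one, Real.norm_eq_abs,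
        abs_of_pos hR]
      ring
    have hcm : Measurable fun p : ℝ × ℝ => ENNReal.ofReal (p.2 ^ m) *
        (g (p.1 • l + p.2 • z) * w ‖p.1 • l + p.2 • z‖) := by fun_prop
    rw [lintegral_upper_half_plane hcm,
      setLIntegral_congr_fun (measurableSet_Ioi.prod measurableSet_Ioo) hpt,
      Measure.volume_eq_prod, ← Measure.prod_restrict]
    exact lintegral_prod_mul (f := fun R => ENNReal.ofReal (R ^ (m + 1)) * w R)
      (g := fun φ => ENNReal.ofReal (Real.sin φ ^ m) * f (Real.cos φ • l + Real.sin φ • z))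
      (by fun_prop) (by fun_prop)
  have hright : ∫⁻ y, g y * w ‖y‖ = c * ∫⁻ ω, (∫⁻ φ in Ioo (0 : ℝ) Real.pi,
      ENNReal.ofReal (Real.sin φ ^ m) *
        f (Real.cos φ • l + Real.sin φ • (ω : (ℝ ∙ l)ᗮ))) ∂surfaceMeasure (ℝ ∙ l)ᗮ := by
    rw [lintegral_eq_lintegral_orthogonal hl (by fun_prop),
      lintegral_eq_lintegral_sphere (by
        have : Measurable fun p : (ℝ ∙ l)ᗮ × ℝ => g (p.2 • l + (p.1 : E)) * w ‖p.2 • l + (p.1 : E)‖ := by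
          fun_prop
        exact this.lintegral_prod_right'), hd, ← lintegral_const_mul' _ _ hctop]
    refine lintegral_congr fun ω => ?_
    rw [← hinner]
    refine lintegral_congr fun r => ?_
    rw [lintegral_const_mul _ (by fun_prop)]
    simp
  exact (ENNReal.mul_right_inj hc0 hctop).1 (hleft.symm.trans hright)

theorem lintegral_exp_neg_norm_sq :
    ∫⁻ z : E, ENNReal.ofReal (Real.exp (-‖z‖ ^ 2)) =
      ENNReal.ofReal (Real.pi ^ ((finrank ℝ E : ℝ) / 2)) := by
  have h := GaussianFourier.integral_rexp_neg_mul_sq_norm (V := E) one_pos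
  simp only [div_one, neg_one_mul] at h
  have hi : Integrable fun z : E => Real.exp (-‖z‖ ^ 2) := by
    by_contra hc
    rw [integral_undef hc] at h
    exact (Real.rpow_pos_of_pos Real.pi_pos _).ne h
  rw [← h, ofReal_integral_eq_lintegral_ofReal hi]
  exact Filter.Eventually.of_forall fun z => (Real.exp_pos _).le

theorem lintegral_even_pow_mul_exp_neg_sq (k : ℕ) :
    ∫⁻ t : ℝ, ENNReal.ofReal (t ^ (2 * k)) * ENNReal.ofReal (Real.exp (-t ^ 2)) =
      ENNReal.ofReal (Real.Gamma (k + 1 / 2)) := by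
  have hk : (-1 : ℝ) < (2 * k : ℕ) := by
    have : (0 : ℝ) ≤ (2 * k : ℕ) := by positivity
    linarith
  have hi := integrable_rpow_mul_exp_neg_mul_sq one_pos hk
  have h1 := integral_comp_abs (f := fun t : ℝ => t ^ (2 * k) * Real.exp (-t ^ 2))
  have h2 := integral_rpow_mul_exp_neg_rpow (p := 2) (q := (2 * k : ℕ)) (by norm_num) hk
  simp only [Real.rpow_natCast, Real.rpow_ofNat, neg_one_mul] at hi h2
  simp only [(even_two_mul k).pow_abs, sq_abs] at h1
  rw [h2] at h1
  have h3 : Real.Gamma (k + 1 / 2) = ∫ t : ℝ, t ^ (2 * k) * Real.exp (-t ^ 2) := by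
    rw [h1]
    push_cast
    rw [show ((2 * k + 1) / 2 : ℝ) = k + 1 / 2 by ring]
    ring
  rw [h3, ofReal_integral_eq_lintegral_ofReal hi]
  · refine lintegral_congr fun t => ?_
    rw [ENNReal.ofReal_mul ((even_two_mul k).pow_nonneg t)]
  · exact Filter.Eventually.of_forall fun t =>
      mul_nonneg ((even_two_mul k).pow_nonneg t) (Real.exp_pos _).le

/-- Even moments of a coordinate on the unit sphere. -/
theorem lintegral_sphere_inner_even_pow {v : E} (hv : ‖v‖ = 1) (k : ℕ) :
    ∫⁻ ζ, ENNReal.ofReal (⟪v, (ζ : E)⟫ ^ (2 * k)) ∂surfaceMeasure E =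
      ENNReal.ofReal (2 * Real.pi ^ (((finrank ℝ E : ℝ) - 1) / 2) * Real.Gamma (k + 1 / 2) /
        Real.Gamma (k + (finrank ℝ E : ℝ) / 2)) := by
  have hv0 : v ≠ 0 := by rintro rfl; simp at hv
  have : Nontrivial E := ⟨v, 0, hv0⟩
  obtain ⟨m, hm⟩ : ∃ m, finrank ℝ E = m + 1 :=
    ⟨_, (Nat.sub_add_cancel (finrank_pos (R := ℝ) (M := E))).symm⟩
  have hd : finrank ℝ (ℝ ∙ v)ᗮ = m := by
    have h2 := (ℝ ∙ v).finrank_add_finrank_orthogonal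
    rw [finrank_span_singleton hv0] at h2
    omega
  -- The Gaussian moment is computed along `v` and its complement here, and in polar coordinates in
  -- `h2`; comparing the two yields the spherical moment.
  have h1 : ∫⁻ y : E, ENNReal.ofReal (⟪v, y⟫ ^ (2 * k)) * ENNReal.ofReal (Real.exp (-‖y‖ ^ 2)) =
      ENNReal.ofReal (Real.pi ^ ((m : ℝ) / 2)) * ENNReal.ofReal (Real.Gamma (k + 1 / 2)) := by
    rw [lintegral_eq_lintegral_orthogonal hv (by fun_prop), ← hd, ← lintegral_exp_neg_norm_sq,
      ← lintegral_mul_const _ (by fun_prop)]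
    refine lintegral_congr fun z => ?_
    rw [← lintegral_even_pow_mul_exp_neg_sq, ← lintegral_const_mul _ (by fun_prop)]
    refine lintegral_congr fun t => ?_
    have h : ⟪v, (z : E)⟫ = 0 := Submodule.mem_orthogonal_singleton_iff_inner_right.1 z.2
    have h' : ⟪v, t • v + (z : E)⟫ = t := by
      rw [inner_add_right, inner_smul_right, h, real_inner_self_eq_norm_sq, hv]
      ring
    rw [h', norm_smul_add_orthogonal_sq hv, neg_add, Real.exp_add,
      ENNReal.ofReal_mul (Real.exp_pos _).le]
    ring
  have h2 : ∫⁻ y : E, ENNReal.ofReal (⟪v, y⟫ ^ (2 * k)) * ENNReal.ofReal (Real.exp (-‖y‖ ^ 2)) =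
      ENNReal.ofReal (Real.Gamma (k + ((m : ℝ) + 1) / 2) / 2) *
        ∫⁻ ζ, ENNReal.ofReal (⟪v, (ζ : E)⟫ ^ (2 * k)) ∂surfaceMeasure E := by
    rw [lintegral_eq_lintegral_sphere (by fun_prop), ← lintegral_const_mul _ (by fun_prop)]
    refine lintegral_congr fun ζ => ?_
    have h3 := lintegral_pow_mul_exp_neg_sq (m + 2 * k)
    rw [show (((m + 2 * k : ℕ) : ℝ) + 1) / 2 = k + ((m : ℝ) + 1) / 2 by push_cast; ring] at h3
    rw [← h3, ← lintegral_mul_const _ (by fun_prop), hm]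
    refine setLIntegral_congr_fun measurableSet_Ioi fun r hr => ?_
    replace hr : 0 < r := hr
    simp only [inner_smul_right, norm_smul, norm_eq_of_mem_sphere, mul_one, Real.norm_eq_abs,
      sq_abs, mul_pow, Nat.add_sub_cancel, pow_add]
    rw [ENNReal.ofReal_mul (by positivity), ENNReal.ofReal_mul (by positivity)]
    ring
  have hG : 0 < Real.Gamma (k + ((m : ℝ) + 1) / 2) := Real.Gamma_pos_of_pos (by positivity)
  have hG' : 0 < Real.Gamma (k + 1 / 2) := Real.Gamma_pos_of_pos (by positivity)
  have h4 := h2.symm.trans h1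
  rw [hm, ← ENNReal.mul_right_inj (a := ENNReal.ofReal (Real.Gamma (k + ((m : ℝ) + 1) / 2) / 2))
    (by simpa using hG) ENNReal.ofReal_ne_top, h4, ← ENNReal.ofReal_mul (by positivity),
    ← ENNReal.ofReal_mul (by positivity)]
  congr 1
  push_cast
  rw [add_sub_cancel_right]
  field_simp

theorem surfaceMeasure_univ [Nontrivial E] :
    surfaceMeasure E univ =
      ENNReal.ofReal (2 * Real.pi ^ ((finrank ℝ E : ℝ) / 2) / Real.Gamma ((finrank ℝ E : ℝ) / 2)) := by
  obtain ⟨v, hv⟩ := exists_norm_eq E zero_le_one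
  have h := lintegral_sphere_inner_even_pow hv 0
  simp only [mul_zero, pow_zero, ENNReal.ofReal_one, lintegral_one, Nat.cast_zero, zero_add,
    Real.Gamma_one_half_eq] at h
  rw [h, Real.sqrt_eq_rpow, mul_assoc, ← Real.rpow_add Real.pi_pos]
  congr 4
  ring

end SphereIntegration

/-! ### The chord involution of the sphere through an interior point, and its Jacobian. -/

section ChordInvolution

open scoped ENNReal

variable {E : Type*} [NormedAddCommGroup E] [InnerProductSpace ℝ E]

/-- For `x` in the unit ball, the positive `s` with `x + s • w` on the unit sphere. -/
noncomputable def chordScale (x w : E) : ℝ :=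
  (Real.sqrt (⟪x, w⟫ ^ 2 + (1 - ‖x‖ ^ 2) * ‖w‖ ^ 2) - ⟪x, w⟫) / ‖w‖ ^ 2

theorem norm_add_smul_eq_one_iff (x w : E) (s : ℝ) :
    ‖x + s • w‖ = 1 ↔ s ^ 2 * ‖w‖ ^ 2 + 2 * s * ⟪x, w⟫ = 1 - ‖x‖ ^ 2 := by
  rw [← sq_eq_sq₀ (norm_nonneg _) zero_le_one, norm_add_sq_real, inner_smul_right, norm_smul,
    mul_pow, Real.norm_eq_abs, sq_abs]
  constructor <;> intro h <;> linarith

theorem chordScale_pos {x w : E} (hx : ‖x‖ < 1) (hw : w ≠ 0) : 0 < chordScale x w := by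
  have hw' : 0 < ‖w‖ := norm_pos_iff.2 hw
  have hx' : 0 < 1 - ‖x‖ ^ 2 := by nlinarith [norm_nonneg x]
  refine div_pos (sub_pos.2 ?_) (by positivity)
  exact Real.lt_sqrt_of_sq_lt (by nlinarith [mul_pos hx' (pow_pos hw' 2)])

theorem norm_add_chordScale_smul {x w : E} (hx : ‖x‖ < 1) (hw : w ≠ 0) :
    ‖x + chordScale x w • w‖ = 1 := by
  have hw' : 0 < ‖w‖ := norm_pos_iff.2 hw
  have hx' : 0 < 1 - ‖x‖ ^ 2 := by nlinarith [norm_nonneg x]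
  have hq := Real.sq_sqrt (show 0 ≤ ⟪x, w⟫ ^ 2 + (1 - ‖x‖ ^ 2) * ‖w‖ ^ 2 by positivity)
  rw [norm_add_smul_eq_one_iff, chordScale]
  field_simp
  linear_combination hq

/-- The quadratic for `s` has roots of opposite sign because `‖x‖ < 1`, so positivity singles one
out. -/
theorem chordScale_eq {x w : E} {s : ℝ} (hx : ‖x‖ < 1) (hw : w ≠ 0) (hs : 0 < s)
    (h : ‖x + s • w‖ = 1) : chordScale x w = s := by
  have hw' : 0 < ‖w‖ := norm_pos_iff.2 hw
  have hx' : 0 < 1 - ‖x‖ ^ 2 := by nlinarith [norm_nonneg x]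
  rw [norm_add_smul_eq_one_iff] at h
  have hpos : 0 ≤ s * ‖w‖ ^ 2 + ⟪x, w⟫ := by
    have : 0 ≤ s * (s * ‖w‖ ^ 2 + ⟪x, w⟫) := by nlinarith [mul_pos (pow_pos hs 2) (pow_pos hw' 2)]
    exact nonneg_of_mul_nonneg_right this hs
  rw [chordScale, div_eq_iff (by positivity), sub_eq_iff_eq_add,
    Real.sqrt_eq_iff_eq_sq (by positivity) hpos]
  linear_combination (-‖w‖ ^ 2) * h

theorem chordScale_smul {x w : E} {r : ℝ} (hx : ‖x‖ < 1) (hw : w ≠ 0) (hr : 0 < r) :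
    chordScale x (r • w) = chordScale x w / r := by
  refine chordScale_eq hx (smul_ne_zero hr.ne' hw) (div_pos (chordScale_pos hx hw) hr) ?_
  rw [smul_smul, div_mul_cancel₀ _ hr.ne', norm_add_chordScale_smul hx hw]

omit [InnerProductSpace ℝ E] in
theorem sub_ne_zero_of_norm {x ζ : E} (hx : ‖x‖ < 1) (hζ : ‖ζ‖ = 1) : ζ - x ≠ 0 := by
  rintro h
  rw [sub_eq_zero.1 h] at hζ
  exact hx.ne hζ

theorem norm_sub_sphere_sq {x ζ : E} (hζ : ‖ζ‖ = 1) :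
    ‖x - ζ‖ ^ 2 = 1 + ‖x‖ ^ 2 - 2 * ⟪x, ζ⟫ := by
  rw [norm_sub_sq_real, hζ]
  ring

theorem chordScale_sub {x ζ : E} (hx : ‖x‖ < 1) (hζ : ‖ζ‖ = 1) : chordScale x (ζ - x) = 1 :=
  chordScale_eq hx (sub_ne_zero_of_norm hx hζ) one_pos (by simpa using hζ)

/-- The second intersection of the unit sphere with the line through `x` and `ζ`. -/
noncomputable def chordReflection (x ζ : E) : E :=
  x + ((1 - ‖x‖ ^ 2) / ‖x - ζ‖ ^ 2) • (x - ζ)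

theorem norm_chordReflection {x ζ : E} (hx : ‖x‖ < 1) (hζ : ‖ζ‖ = 1) :
    ‖chordReflection x ζ‖ = 1 := by
  have hw' : 0 < ‖x - ζ‖ := by
    rw [norm_sub_rev]; exact norm_pos_iff.2 (sub_ne_zero_of_norm hx hζ)
  rw [chordReflection, norm_add_smul_eq_one_iff]
  have h1 := norm_sub_sphere_sq (x := x) hζ
  have h2 : ⟪x, x - ζ⟫ = ‖x‖ ^ 2 - ⟪x, ζ⟫ := by
    rw [inner_sub_right, real_inner_self_eq_norm_sq]
  rw [h2]
  field_simp
  linear_combination (- (1 - ‖x‖ ^ 2)) * h1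

theorem chordScale_sub_rev {x ζ : E} (hx : ‖x‖ < 1) (hζ : ‖ζ‖ = 1) :
    chordScale x (x - ζ) = (1 - ‖x‖ ^ 2) / ‖x - ζ‖ ^ 2 := by
  have hw : x - ζ ≠ 0 := by
    rw [← neg_ne_zero, neg_sub]; exact sub_ne_zero_of_norm hx hζ
  have hx' : 0 < 1 - ‖x‖ ^ 2 := by nlinarith [norm_nonneg x]
  have hw' : 0 < ‖x - ζ‖ := norm_pos_iff.2 hw
  exact chordScale_eq hx hw (by positivity) (norm_chordReflection hx hζ)

theorem sub_chordReflection (x ζ : E) :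
    x - chordReflection x ζ = -((1 - ‖x‖ ^ 2) / ‖x - ζ‖ ^ 2) • (x - ζ) := by
  rw [chordReflection, neg_smul]; abel

theorem norm_sub_chordReflection {x ζ : E} (hx : ‖x‖ < 1) (hζ : ‖ζ‖ = 1) :
    ‖x - chordReflection x ζ‖ = (1 - ‖x‖ ^ 2) / ‖x - ζ‖ := by
  have hw' : 0 < ‖x - ζ‖ := by
    rw [norm_sub_rev]; exact norm_pos_iff.2 (sub_ne_zero_of_norm hx hζ)
  have hx' : 0 < 1 - ‖x‖ ^ 2 := by nlinarith [norm_nonneg x]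
  rw [sub_chordReflection, norm_smul, norm_neg, Real.norm_eq_abs, abs_of_pos (by positivity)]
  field_simp

theorem one_sub_inner_chordReflection {x ζ : E} (hx : ‖x‖ < 1) (hζ : ‖ζ‖ = 1) :
    1 - ⟪x, chordReflection x ζ⟫ = (1 - ‖x‖ ^ 2) / ‖x - ζ‖ ^ 2 * (1 - ⟪x, ζ⟫) := by
  have hw' : 0 < ‖x - ζ‖ := by
    rw [norm_sub_rev]; exact norm_pos_iff.2 (sub_ne_zero_of_norm hx hζ)
  have h1 := norm_sub_sphere_sq (x := x) hζ
  have h2 := norm_sub_sphere_sq (x := x) (norm_chordReflection hx hζ)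
  rw [norm_sub_chordReflection hx hζ] at h2
  have h3 : ⟪x, chordReflection x ζ⟫ = (1 + ‖x‖ ^ 2 - ((1 - ‖x‖ ^ 2) / ‖x - ζ‖) ^ 2) / 2 := by linarith
  have h4 : ⟪x, ζ⟫ = (1 + ‖x‖ ^ 2 - ‖x - ζ‖ ^ 2) / 2 := by linarith
  rw [h3, h4]
  field_simp
  ring

variable [FiniteDimensional ℝ E] [MeasurableSpace E] [BorelSpace E]

/-- The map `y ↦ y - ‖y‖ • x`, whose restriction to the unit sphere is translation by `-x`. -/
theorem lintegral_comp_sub_norm_smul {x : E} (hx : ‖x‖ < 1) [Nontrivial E] (g : E → ℝ≥0∞) :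
    ∫⁻ w, g w = ∫⁻ y, ENNReal.ofReal (1 - ⟪x, ‖y‖⁻¹ • y⟫) * g (y - ‖y‖ • x) := by
  set L : E → E := fun y => y - ‖y‖ • x with hL
  -- `y ↦ ‖y‖ • x` is a contraction with constant `‖x‖ < 1`, so the identity minus it is injective.
  have hinj : InjOn L {0}ᶜ := by
    intro y _ z _ h
    have h1 : y - z = (‖y‖ - ‖z‖) • x := by
      rw [sub_smul, sub_eq_sub_iff_sub_eq_sub]; exact h
    have h2 : ‖y - z‖ ≤ ‖y - z‖ * ‖x‖ := by
      conv_lhs => rw [h1, norm_smul]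
      gcongr
      exact abs_norm_sub_norm_le y z
    have h3 : ‖y - z‖ = 0 := by
      by_contra h0
      have : 0 < ‖y - z‖ := lt_of_le_of_ne (norm_nonneg _) (Ne.symm h0)
      nlinarith
    exact sub_eq_zero.1 (norm_eq_zero.1 h3)
  have himg : L '' {0}ᶜ = {0}ᶜ := by
    ext w
    constructor
    · rintro ⟨y, hy, rfl⟩ h0
      have h0 : y - ‖y‖ • x = 0 := h0
      have hy' : 0 < ‖y‖ := norm_pos_iff.2 hy
      have : ‖y‖ = ‖y‖ * ‖x‖ := by
        conv_lhs => rw [sub_eq_zero.1 h0, norm_smul, norm_norm]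
      nlinarith
    -- A preimage `y` of `w` is `w + ‖y‖ • x`, where `‖y‖` must be the gauge of the translated
    -- sphere at `w`, namely `(chordScale x w)⁻¹`.
    · intro hw
      have hw : w ≠ 0 := hw
      have hR := chordScale_pos hx hw
      have hn : ‖w + (chordScale x w)⁻¹ • x‖ = (chordScale x w)⁻¹ := by
        have : w + (chordScale x w)⁻¹ • x = (chordScale x w)⁻¹ • (x + chordScale x w • w) := by
          rw [smul_add, smul_smul, inv_mul_cancel₀ hR.ne', one_smul, add_comm]
        rw [this, norm_smul, norm_add_chordScale_smul hx hw, Real.norm_eq_abs,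
          abs_of_pos (inv_pos.2 hR), mul_one]
      refine ⟨w + (chordScale x w)⁻¹ • x, ?_, ?_⟩
      · rw [mem_compl_singleton_iff, ← norm_pos_iff, hn]
        exact inv_pos.2 hR
      · simp only [hL, hn]
        abel
  have hder : ∀ y ∈ ({0}ᶜ : Set E), HasFDerivWithinAt L
      (ContinuousLinearMap.id ℝ E - (‖y‖⁻¹ • innerSL ℝ y).smulRight x) {0}ᶜ y := by
    intro y hy
    have hy' : 0 < ‖y‖ := norm_pos_iff.2 hy
    have h1 : HasFDerivAt (fun y : E => ‖y‖) (‖y‖⁻¹ • innerSL ℝ y) y := by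
      have h2 := ((hasStrictFDerivAt_norm_sq y).hasFDerivAt).sqrt (by positivity)
      simp only [Real.sqrt_sq (norm_nonneg _)] at h2
      convert h2 using 1
      ext z
      simp
      field_simp
    exact ((hasFDerivAt_id y).sub (h1.smul_const x)).hasFDerivWithinAt
  have hdet : ∀ y ∈ ({0}ᶜ : Set E), |(ContinuousLinearMap.id ℝ E -
      (‖y‖⁻¹ • innerSL ℝ y).smulRight x).det| = 1 - ⟪x, ‖y‖⁻¹ • y⟫ := by
    intro y hy
    have hy' : 0 < ‖y‖ := norm_pos_iff.2 hy
    -- The derivative is a rank-one perturbation of the identity, so its determinant is one plus the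
    -- functional evaluated at `x`.
    have h1 : ((ContinuousLinearMap.id ℝ E - (‖y‖⁻¹ • innerSL ℝ y).smulRight x : E →L[ℝ] E) :
        E →ₗ[ℝ] E) = LinearMap.transvection (-(‖y‖⁻¹ • innerₛₗ ℝ y)) x := by
      ext z
      simp [LinearMap.transvection, sub_eq_add_neg]
    rw [ContinuousLinearMap.det, h1, LinearMap.transvection.det]
    have h2 : ⟪x, ‖y‖⁻¹ • y⟫ < 1 := by
      refine (real_inner_le_norm _ _).trans_lt ?_
      rw [norm_smul, norm_inv, norm_norm, inv_mul_cancel₀ hy'.ne', mul_one]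
      exact hx
    have h3 : 1 + (-(‖y‖⁻¹ • innerₛₗ ℝ y)) x = 1 - ⟪x, ‖y‖⁻¹ • y⟫ := by
      simp [inner_smul_right, real_inner_comm, sub_eq_add_neg]
    rw [h3, abs_of_pos (by linarith)]
  have h := lintegral_image_eq_lintegral_abs_det_fderiv_mul volume
    (measurableSet_singleton (0 : E)).compl hder hinj g
  have h' : ∀ y ∈ ({0}ᶜ : Set E), ENNReal.ofReal |(ContinuousLinearMap.id ℝ E -
      (‖y‖⁻¹ • innerSL ℝ y).smulRight x).det| * g (L y) =
      ENNReal.ofReal (1 - ⟪x, ‖y‖⁻¹ • y⟫) * g (L y) := fun y hy => by rw [hdet y hy]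
  rw [himg, setLIntegral_congr_fun (measurableSet_singleton (0 : E)).compl h',
    restrict_compl_singleton] at h
  exact h

theorem lintegral_mul_exp_neg {a : ℝ} (ha : 0 < a) :
    ∫⁻ r in Ioi (0 : ℝ), ENNReal.ofReal (a * Real.exp (-(a * r))) = 1 := by
  have h1 := integral_exp_mul_Ioi (a := -a) (by linarith) 0
  have h2 := integrableOn_exp_mul_Ioi (a := -a) (by linarith) 0
  rw [← ofReal_integral_eq_lintegral_ofReal]
  · simp only [← neg_mul]
    rw [integral_const_mul, h1]
    simp [ha.ne']
  · simpa only [← neg_mul] using h2.const_mul a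
  · exact Filter.Eventually.of_forall fun r => by positivity

/-- For `f` homogeneous of degree `-n` the radial field `f(w) w` is divergence-free, so its flux
through the unit sphere equals that through the sphere translated by `-x`; `1 - ⟪x, ζ⟫` is the
normal component there. In place of the divergence theorem, one integral `I` over `E` is computed in
two radial parametrizations. Its weight is a function of the gauge of the translated sphere, and
each ray contributes `f` at its direction vector whatever the scale `a` (`hray`). -/
theorem lintegral_sphere_sub_of_homogeneous [Nontrivial E] {x : E} (hx : ‖x‖ < 1) {f : E → ℝ≥0∞}
    (hf : Measurable f)
    (hom : ∀ (r : ℝ) (w : E), 0 < r → ENNReal.ofReal (r ^ finrank ℝ E) * f (r • w) = f w) :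
    ∫⁻ ζ, ENNReal.ofReal (1 - ⟪x, (ζ : E)⟫) * f (ζ - x) ∂surfaceMeasure E =
      ∫⁻ ζ, f ζ ∂surfaceMeasure E := by
  have hn : 0 < finrank ℝ E := finrank_pos
  have hR : Measurable (chordScale x) := by
    unfold chordScale
    fun_prop
  have hpow : ∀ r : ℝ, 0 < r → r ^ (finrank ℝ E - 1) = r⁻¹ * r ^ finrank ℝ E := by
    intro r hr
    obtain ⟨m, hm⟩ : ∃ m, finrank ℝ E = m + 1 := ⟨_, (Nat.sub_add_cancel hn).symm⟩
    rw [hm, Nat.add_sub_cancel, pow_succ]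
    field_simp
  set I : ℝ≥0∞ := ∫⁻ w, f w * ENNReal.ofReal ((chordScale x w)⁻¹ * Real.exp (-(chordScale x w)⁻¹))
    with hI
  have hray : ∀ (w : E) (a : ℝ), 0 < a → ∫⁻ r in Ioi (0 : ℝ), ENNReal.ofReal (r ^ (finrank ℝ E - 1)) *
      (f (r • w) * ENNReal.ofReal ((a * r) * Real.exp (-(a * r)))) = f w := by
    intro w a ha
    have : ∀ r ∈ Ioi (0 : ℝ), ENNReal.ofReal (r ^ (finrank ℝ E - 1)) *
        (f (r • w) * ENNReal.ofReal ((a * r) * Real.exp (-(a * r)))) =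
        f w * ENNReal.ofReal (a * Real.exp (-(a * r))) := by
      intro r hr
      replace hr : 0 < r := hr
      rw [hpow r hr, ENNReal.ofReal_mul (by positivity), ← hom r w hr]
      have : a * r * Real.exp (-(a * r)) = r * (a * Real.exp (-(a * r))) := by ring
      rw [this, ENNReal.ofReal_mul hr.le]
      have h1 : ENNReal.ofReal r⁻¹ * ENNReal.ofReal r = 1 := by
        rw [← ENNReal.ofReal_mul (by positivity), inv_mul_cancel₀ hr.ne', ENNReal.ofReal_one]
      calc _ = (ENNReal.ofReal r⁻¹ * ENNReal.ofReal r) * (ENNReal.ofReal (r ^ finrank ℝ E) *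
            f (r • w) * ENNReal.ofReal (a * Real.exp (-(a * r)))) := by ring
        _ = _ := by rw [h1, one_mul]
    rw [setLIntegral_congr_fun measurableSet_Ioi this, lintegral_const_mul _ (by fun_prop),
      lintegral_mul_exp_neg ha, mul_one]
  have h1 : I = ∫⁻ ζ, f ζ ∂surfaceMeasure E := by
    rw [hI, lintegral_eq_lintegral_sphere (by fun_prop)]
    refine lintegral_congr fun θ => ?_
    have hθ : (θ : E) ≠ 0 := by
      rw [← norm_pos_iff, norm_eq_of_mem_sphere]; exact one_pos
    rw [← hray θ (chordScale x θ)⁻¹ (inv_pos.2 (chordScale_pos hx hθ))]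
    refine setLIntegral_congr_fun measurableSet_Ioi fun r hr => ?_
    rw [chordScale_smul hx hθ hr, inv_div, div_eq_inv_mul]
  have h2 : I = ∫⁻ ζ, ENNReal.ofReal (1 - ⟪x, (ζ : E)⟫) * f (ζ - x) ∂surfaceMeasure E := by
    rw [hI, lintegral_comp_sub_norm_smul hx, lintegral_eq_lintegral_sphere (by fun_prop)]
    refine lintegral_congr fun ζ => ?_
    have hζ : ‖(ζ : E)‖ = 1 := norm_eq_of_mem_sphere ζ
    rw [← hray (ζ - x) 1 one_pos, ← lintegral_const_mul _ (by fun_prop)]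
    refine setLIntegral_congr_fun measurableSet_Ioi fun r hr => ?_
    replace hr : 0 < r := hr
    have h3 : ‖r • (ζ : E)‖ = r := by rw [norm_smul, hζ, Real.norm_eq_abs, abs_of_pos hr, mul_one]
    simp only [h3, ← smul_sub, smul_smul, inv_mul_cancel₀ hr.ne', one_smul, one_mul]
    rw [chordScale_smul hx (sub_ne_zero_of_norm hx hζ) hr, chordScale_sub hx hζ, one_div, inv_inv]
    ring
  rw [← h2, h1]

/-- Antipodal symmetry is inherited from that of Lebesgue measure through the Gaussian weight. -/
theorem lintegral_sphere_neg [Nontrivial E] {f : E → ℝ≥0∞} (hf : Measurable f) :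
    ∫⁻ ζ, f (-ζ) ∂surfaceMeasure E = ∫⁻ ζ, f ζ ∂surfaceMeasure E := by
  have hw : Measurable fun r : ℝ => ENNReal.ofReal (Real.exp (-r ^ 2)) := by fun_prop
  have hhom : ∀ (r : ℝ) (y : E), 0 < r → ‖r • y‖⁻¹ • r • y = ‖y‖⁻¹ • y := by
    intro r y hr
    rw [norm_smul, Real.norm_eq_abs, abs_of_pos hr, smul_smul, mul_inv]
    congr 1
    field_simp
  have key := fun (g : E → ℝ≥0∞) (hg : Measurable g) =>
    lintegral_sphere_radial_weight (f := fun y => g (‖y‖⁻¹ • y)) (by fun_prop) hw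
      (fun r y hr => by rw [hhom r y hr])
  simp only [norm_eq_of_mem_sphere, inv_one, one_smul, lintegral_pow_mul_exp_neg_sq] at key
  have h1 := key f hf
  have h2 := key (fun y => f (-y)) (by fun_prop)
  rw [← lintegral_neg_eq_self] at h1
  simp only [norm_neg, smul_neg] at h1
  have hG : 0 < Real.Gamma (((finrank ℝ E - 1 : ℕ) + 1 : ℝ) / 2) :=
    Real.Gamma_pos_of_pos (by positivity)
  exact (ENNReal.mul_right_inj (by simpa using hG) ENNReal.ofReal_ne_top).1 (h2.symm.trans h1)

/-- Change of variables on the unit sphere by the chord involution through `x`. -/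
theorem lintegral_sphere_chordReflection [Nontrivial E] {x : E} (hx : ‖x‖ < 1) {g : E → ℝ≥0∞}
    (hg : Measurable g) :
    ∫⁻ ζ, g ζ ∂surfaceMeasure E = ∫⁻ ζ,
      ENNReal.ofReal (((1 - ‖x‖ ^ 2) / ‖x - ζ‖ ^ 2) ^ (finrank ℝ E - 1)) *
        g (chordReflection x ζ) ∂surfaceMeasure E := by
  have hn : 0 < finrank ℝ E := finrank_pos
  have hR : Measurable (chordScale x) := by
    unfold chordScale
    fun_prop
  have hin : ∀ ζ : E, ‖ζ‖ = 1 → 0 < 1 - ⟪x, ζ⟫ := fun ζ hζ => by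
    have := real_inner_le_norm x ζ
    rw [hζ] at this
    linarith
  -- The extension of `g`, homogeneous of degree `-n` about `x`, for which `(1 - ⟪x, ζ⟫) * f (ζ - x)
  -- = g ζ`. At `x - ζ` it sees the opposite end of the chord, so comparing the flux identity for
  -- `f` and for `f ∘ neg` gives the involution formula.
  set f : E → ℝ≥0∞ := fun w => ENNReal.ofReal (chordScale x w ^ finrank ℝ E) *
    ((ENNReal.ofReal (1 - ⟪x, x + chordScale x w • w⟫))⁻¹ * g (x + chordScale x w • w)) with hf
  have hfm : Measurable f := by fun_prop
  have hom : ∀ (r : ℝ) (w : E), 0 < r → ENNReal.ofReal (r ^ finrank ℝ E) * f (r • w) = f w := by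
    intro r w hr
    -- Division by zero makes `chordScale x 0 = 0`; as the dimension is positive, `f 0 = 0` and
    -- homogeneity persists there.
    by_cases hw : w = 0
    · simp [hf, hw, chordScale, hn.ne']
    · simp only [hf, chordScale_smul hx hw hr, smul_smul, div_mul_cancel₀ _ hr.ne']
      rw [← mul_assoc, ← ENNReal.ofReal_mul (by positivity), ← mul_pow, mul_div_cancel₀ _ hr.ne']
  have h1 := lintegral_sphere_sub_of_homogeneous hx hfm hom
  have h2 := lintegral_sphere_sub_of_homogeneous hx (f := fun w => f (-w)) (by fun_prop)
    (fun r w hr => by rw [← smul_neg, hom r _ hr])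
  rw [lintegral_sphere_neg hfm, ← h1] at h2
  have h3 : ∀ ζ : Metric.sphere (0 : E) 1, ENNReal.ofReal (1 - ⟪x, (ζ : E)⟫) * f (ζ - x) = g ζ := by
    intro ζ
    have hζ : ‖(ζ : E)‖ = 1 := norm_eq_of_mem_sphere ζ
    simp only [hf, chordScale_sub hx hζ, one_pow, one_smul, add_sub_cancel, ENNReal.ofReal_one,
      one_mul]
    rw [← mul_assoc, ENNReal.mul_inv_cancel (by simpa using hin ζ hζ) ENNReal.ofReal_ne_top,
      one_mul]
  have h4 : ∀ ζ : Metric.sphere (0 : E) 1, ENNReal.ofReal (1 - ⟪x, (ζ : E)⟫) * f (-(ζ - x)) =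
      ENNReal.ofReal (((1 - ‖x‖ ^ 2) / ‖x - ζ‖ ^ 2) ^ (finrank ℝ E - 1)) *
        g (chordReflection x ζ) := by
    intro ζ
    have hζ : ‖(ζ : E)‖ = 1 := norm_eq_of_mem_sphere ζ
    have hw' : 0 < ‖x - ζ‖ := by
      rw [norm_sub_rev]; exact norm_pos_iff.2 (sub_ne_zero_of_norm hx hζ)
    have hx' : 0 < 1 - ‖x‖ ^ 2 := by nlinarith [norm_nonneg x]
    have hκ : 0 < (1 - ‖x‖ ^ 2) / ‖x - ζ‖ ^ 2 := by positivity
    simp only [hf, neg_sub, chordScale_sub_rev hx hζ]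
    rw [← chordReflection, one_sub_inner_chordReflection hx hζ,
      ← ENNReal.ofReal_inv_of_pos (mul_pos hκ (hin ζ hζ)), ← mul_assoc, ← mul_assoc,
      ← ENNReal.ofReal_mul (hin ζ hζ).le,
      ← ENNReal.ofReal_mul (mul_nonneg (hin ζ hζ).le (by positivity))]
    congr 2
    obtain ⟨m, hm⟩ : ∃ m, finrank ℝ E = m + 1 := ⟨_, (Nat.sub_add_cancel hn).symm⟩
    have := (hin ζ hζ).ne'
    rw [hm, Nat.add_sub_cancel, pow_succ]
    field_simp
  simp only [h3, h4] at h2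
  exact h2.symm

/-- The Poisson kernel of the unit ball, up to normalization. -/
noncomputable def poissonKernelBall (x ζ : E) : ℝ :=
  (1 - ‖x‖ ^ 2) / ‖x - ζ‖ ^ finrank ℝ E

/-- Since `1 - ⟪x, ζ⟫ = (1 - ‖x‖² + ‖x - ζ‖²) / 2`, the flux density of `‖w‖ ^ (-n)` is half the
Poisson kernel plus half its transform under the chord involution. Both halves have the same
integral, and the flux through the unit sphere is the total area. -/
theorem lintegral_poissonKernelBall [Nontrivial E] {x : E} (hx : ‖x‖ < 1) :
    ∫⁻ ζ, ENNReal.ofReal (poissonKernelBall x ζ) ∂surfaceMeasure E = surfaceMeasure E univ := by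
  have hn : 0 < finrank ℝ E := finrank_pos
  have hx' : 0 < 1 - ‖x‖ ^ 2 := by nlinarith [norm_nonneg x]
  have hP : Measurable (poissonKernelBall x) := by unfold poissonKernelBall; fun_prop
  have hw : ∀ ζ : Metric.sphere (0 : E) 1, 0 < ‖x - ζ‖ := fun ζ => by
    rw [norm_sub_rev]
    exact norm_pos_iff.2 (sub_ne_zero_of_norm hx (norm_eq_of_mem_sphere ζ))
  obtain ⟨m, hm⟩ : ∃ m, finrank ℝ E = m + 1 := ⟨_, (Nat.sub_add_cancel hn).symm⟩
  have h1 := lintegral_sphere_chordReflection hx (g := fun ζ => ENNReal.ofReal (poissonKernelBall x ζ))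
    (by fun_prop)
  have h2 := lintegral_sphere_sub_of_homogeneous hx
    (f := fun w => ENNReal.ofReal ((‖w‖ ^ finrank ℝ E)⁻¹)) (by fun_prop) (by
      intro r w hr
      by_cases hw : w = 0
      · simp [hw, hn.ne']
      · have : 0 < ‖w‖ := norm_pos_iff.2 hw
        rw [← ENNReal.ofReal_mul (by positivity), norm_smul, Real.norm_eq_abs, abs_of_pos hr,
          mul_pow]
        congr 1
        field_simp)
  simp only [norm_eq_of_mem_sphere, one_pow, inv_one, ENNReal.ofReal_one, lintegral_one] at h2
  rw [← h2]
  have h3 : ∀ ζ : Metric.sphere (0 : E) 1, ENNReal.ofReal (1 - ⟪x, (ζ : E)⟫) *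
      ENNReal.ofReal ((‖(ζ : E) - x‖ ^ finrank ℝ E)⁻¹) =
      2⁻¹ * ENNReal.ofReal (poissonKernelBall x ζ) + 2⁻¹ *
      (ENNReal.ofReal (((1 - ‖x‖ ^ 2) / ‖x - ζ‖ ^ 2) ^ (finrank ℝ E - 1)) *
        ENNReal.ofReal (poissonKernelBall x (chordReflection x ζ))) := by
    intro ζ
    have hζ : ‖(ζ : E)‖ = 1 := norm_eq_of_mem_sphere ζ
    have hwζ := hw ζ
    have h4 : (2⁻¹ : ℝ≥0∞) = ENNReal.ofReal 2⁻¹ := by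
      rw [ENNReal.ofReal_inv_of_pos two_pos]; simp
    have hin : 1 - ⟪x, (ζ : E)⟫ = (1 - ‖x‖ ^ 2 + ‖x - ζ‖ ^ 2) / 2 := by
      rw [norm_sub_sphere_sq hζ]; ring
    rw [h4, hin, poissonKernelBall, poissonKernelBall, norm_sub_chordReflection hx hζ,
      ← ENNReal.ofReal_mul (by positivity), ← ENNReal.ofReal_mul (by positivity),
      ← ENNReal.ofReal_mul (by positivity), ← ENNReal.ofReal_mul (by positivity),
      ← ENNReal.ofReal_add (by positivity) (by positivity), hm, Nat.add_sub_cancel,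
      norm_sub_rev (ζ : E) x, div_pow, div_pow, ← pow_mul]
    congr 1
    field_simp
    ring
  simp only [h3]
  rw [lintegral_add_left (by fun_prop), lintegral_const_mul _ (by fun_prop),
    lintegral_const_mul' _ _ (by simp), ← h1, ← add_mul, ENNReal.inv_two_add_inv_two, one_mul]

end ChordInvolution

open Filter Topology InnerProductSpace

/-! ### Poisson integrals: differentiation under the integral and harmonicity. -/

section PoissonIntegral

open scoped ENNReal ContDiff

variable {E : Type*} [NormedAddCommGroup E] [InnerProductSpace ℝ E] [FiniteDimensional ℝ E]

theorem laplacian_eq_sum_fderiv_fderiv {ι : Type*} [Fintype ι] (b : OrthonormalBasis ι ℝ E)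
    (f : E → ℝ) (x : E) :
    Laplacian.laplacian f x = ∑ i, fderiv ℝ (fderiv ℝ f) x (b i) (b i) := by
  rw [laplacian_eq_iteratedFDeriv_orthonormalBasis f b]
  simp [iteratedFDeriv_two_apply]

omit [FiniteDimensional ℝ E] in
/-- The Poisson kernel with the power of the distance written as a power of its square. -/
theorem poissonKernelBall_eq_rpow (x ζ : E) :
    poissonKernelBall x ζ = (1 - ‖x‖ ^ 2) * (‖x - ζ‖ ^ 2) ^ (-((finrank ℝ E : ℝ) / 2)) := by
  have h : (‖x - ζ‖ ^ 2) ^ (-((finrank ℝ E : ℝ) / 2)) = (‖x - ζ‖ ^ finrank ℝ E)⁻¹ := by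
    rw [Real.rpow_neg (by positivity), ← Real.rpow_natCast ‖x - ζ‖ 2,
      ← Real.rpow_natCast ‖x - ζ‖ (finrank ℝ E), ← Real.rpow_mul (norm_nonneg _)]
    congr 2
    push_cast
    ring
  rw [poissonKernelBall, div_eq_mul_inv, h]

omit [FiniteDimensional ℝ E] in
/-- The directional derivative of the Poisson kernel. -/
theorem hasFDerivAt_poissonKernelBall {x ζ : E} (h : x ≠ ζ) :
    HasFDerivAt (fun y => poissonKernelBall y ζ)
      ((-2 * (‖x - ζ‖ ^ 2) ^ (-((finrank ℝ E : ℝ) / 2))) • innerSL ℝ x -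
        (finrank ℝ E * (1 - ‖x‖ ^ 2) * (‖x - ζ‖ ^ 2) ^ (-((finrank ℝ E : ℝ) / 2) - 1)) •
          innerSL ℝ (x - ζ)) x := by
  have hw : 0 < ‖x - ζ‖ := norm_pos_iff.2 (sub_ne_zero.2 h)
  have h1 : HasFDerivAt (fun y : E => 1 - ‖y‖ ^ 2) (-(2 • innerSL ℝ x)) x := by
    simpa using ((hasStrictFDerivAt_norm_sq x).hasFDerivAt).const_sub 1
  have h2 : HasFDerivAt (fun y : E => ‖y - ζ‖ ^ 2) (2 • innerSL ℝ (x - ζ)) x := by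
    simpa using ((hasFDerivAt_id x).sub_const ζ).norm_sq
  have h3 := h1.mul (h2.rpow_const (p := -((finrank ℝ E : ℝ) / 2)) (Or.inl (by positivity)))
  simp only [poissonKernelBall_eq_rpow]
  refine h3.congr_fderiv ?_
  ext v
  simp
  ring

omit [FiniteDimensional ℝ E] in
-- The products are arranged as `⟪p, v⟫ * ⟪v, q⟫` so that summing over an orthonormal basis
-- collapses them by Parseval.
theorem fderiv_fderiv_poissonKernelBall {x ζ : E} (h : x ≠ ζ) (v : E) :
    fderiv ℝ (fderiv ℝ fun y => poissonKernelBall y ζ) x v v =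
      -2 * (‖x - ζ‖ ^ 2) ^ (-((finrank ℝ E : ℝ) / 2)) * ‖v‖ ^ 2 +
      4 * finrank ℝ E * (‖x - ζ‖ ^ 2) ^ (-((finrank ℝ E : ℝ) / 2) - 1) * (⟪x, v⟫ * ⟪v, x - ζ⟫) +
      (finrank ℝ E * (finrank ℝ E + 2) * (1 - ‖x‖ ^ 2) *
        (‖x - ζ‖ ^ 2) ^ (-((finrank ℝ E : ℝ) / 2) - 2)) * (⟪x - ζ, v⟫ * ⟪v, x - ζ⟫) -
      finrank ℝ E * (1 - ‖x‖ ^ 2) * (‖x - ζ‖ ^ 2) ^ (-((finrank ℝ E : ℝ) / 2) - 1) * ‖v‖ ^ 2 := by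
  have hw : 0 < ‖x - ζ‖ := norm_pos_iff.2 (sub_ne_zero.2 h)
  have h1 : HasFDerivAt (fun y : E => 1 - ‖y‖ ^ 2) (-(2 • innerSL ℝ x)) x := by
    simpa using ((hasStrictFDerivAt_norm_sq x).hasFDerivAt).const_sub 1
  have h2 : HasFDerivAt (fun y : E => ‖y - ζ‖ ^ 2) (2 • innerSL ℝ (x - ζ)) x := by
    simpa using ((hasFDerivAt_id x).sub_const ζ).norm_sq
  have h3 : HasFDerivAt (innerSL ℝ : E →L[ℝ] E →L[ℝ] ℝ) (innerSL ℝ) x :=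
    ContinuousLinearMap.hasFDerivAt _
  have h4 : HasFDerivAt (fun y => innerSL ℝ (y - ζ) : E → E →L[ℝ] ℝ) (innerSL ℝ) x := by
    simpa only [map_sub] using h3.sub_const (innerSL ℝ ζ)
  have hA := ((h2.rpow_const (p := -((finrank ℝ E : ℝ) / 2)) (Or.inl (by positivity))).const_mul
    (-2)).smul h3
  have hB := ((h1.const_mul (finrank ℝ E : ℝ)).mul
    (h2.rpow_const (p := -((finrank ℝ E : ℝ) / 2) - 1) (Or.inl (by positivity)))).smul h4
  have hev : (fderiv ℝ fun y => poissonKernelBall y ζ) =ᶠ[𝓝 x] fun y =>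
      (-2 * (‖y - ζ‖ ^ 2) ^ (-((finrank ℝ E : ℝ) / 2))) • innerSL ℝ y -
        (finrank ℝ E * (1 - ‖y‖ ^ 2) * (‖y - ζ‖ ^ 2) ^ (-((finrank ℝ E : ℝ) / 2) - 1)) •
          innerSL ℝ (y - ζ) := by
    filter_upwards [isOpen_ne.mem_nhds h] with y hy
    exact (hasFDerivAt_poissonKernelBall hy).fderiv
  have key := ((hA.sub hB).congr_of_eventuallyEq hev).fderiv
  rw [key]
  simp [inner_sub_left, inner_sub_right, real_inner_comm x v, real_inner_comm ζ v]
  have hvv : (innerSL ℝ : E →L[ℝ] E →L[ℝ] ℝ) v v = ‖v‖ ^ 2 := real_inner_self_eq_norm_sq v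
  rw [hvv, show -((finrank ℝ E : ℝ) / 2) - 2 = -((finrank ℝ E : ℝ) / 2) - 1 - 1 by ring]
  ring

theorem laplacian_poissonKernelBall {x ζ : E} (h : x ≠ ζ) (hζ : ‖ζ‖ = 1) :
    Laplacian.laplacian (fun y => poissonKernelBall y ζ) x = 0 := by
  have hw : 0 < ‖x - ζ‖ := norm_pos_iff.2 (sub_ne_zero.2 h)
  set b := stdOrthonormalBasis ℝ E
  rw [laplacian_eq_sum_fderiv_fderiv b]
  simp only [fderiv_fderiv_poissonKernelBall h, Finset.sum_sub_distrib, Finset.sum_add_distrib,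
    ← Finset.mul_sum, b.sum_inner_mul_inner, b.norm_eq_one]
  simp only [one_pow, Finset.sum_const, Finset.card_univ, Fintype.card_fin, nsmul_eq_mul, mul_one,
    real_inner_self_eq_norm_sq]
  have h1 : (‖x - ζ‖ ^ 2) ^ (-((finrank ℝ E : ℝ) / 2) - 1) =
      (‖x - ζ‖ ^ 2) ^ (-((finrank ℝ E : ℝ) / 2) - 2) * ‖x - ζ‖ ^ 2 := by
    rw [← Real.rpow_add_one (by positivity)]; congr 1; ring
  have h0 : (‖x - ζ‖ ^ 2) ^ (-((finrank ℝ E : ℝ) / 2)) =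
      (‖x - ζ‖ ^ 2) ^ (-((finrank ℝ E : ℝ) / 2) - 2) * ‖x - ζ‖ ^ 2 * ‖x - ζ‖ ^ 2 := by
    rw [← h1, ← Real.rpow_add_one (by positivity)]; congr 1; ring
  have h2 := norm_sub_sphere_sq (x := x) hζ
  have h3 : ⟪x, x - ζ⟫ = ‖x‖ ^ 2 - ⟪x, ζ⟫ := by rw [inner_sub_right, real_inner_self_eq_norm_sq]
  have h4 : ⟪x, ζ⟫ = (1 + ‖x‖ ^ 2 - ‖x - ζ‖ ^ 2) / 2 := by linarith
  rw [h0, h1, h3, h4]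
  ring

omit [FiniteDimensional ℝ E] in
/-- Smoothness of the Poisson kernel in both variables. -/
theorem contDiffAt_poissonKernelBall {p : E × E} (h : p.1 ≠ p.2) :
    ContDiffAt ℝ ∞ (Function.uncurry (poissonKernelBall : E → E → ℝ)) p := by
  have hw : ‖p.1 - p.2‖ ≠ 0 := norm_ne_zero_iff.2 (sub_ne_zero.2 h)
  have h1 : ContDiffAt ℝ ∞ (fun q : E × E => ‖q.1 - q.2‖) p :=
    (contDiffAt_fst.sub contDiffAt_snd).norm ℝ (sub_ne_zero.2 h)
  exact ((contDiffAt_const.sub (contDiffAt_fst.norm_sq ℝ)).div (h1.pow _) (pow_ne_zero _ hw))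

variable {F : Type*} [NormedAddCommGroup F] [NormedSpace ℝ F]

omit [FiniteDimensional ℝ E] in
-- Kernels smooth off the diagonal are stable under differentiation in the first variable, so
-- differentiation under the integral can be iterated.
theorem ContDiffAt.uncurry_fderiv_left {K : E → E → F} {p : E × E}
    (hK : ContDiffAt ℝ ∞ (Function.uncurry K) p) :
    ContDiffAt ℝ ∞ (Function.uncurry fun x ζ => fderiv ℝ (fun y => K y ζ) x) p := by
  have : ContDiffAt ℝ ∞ (Function.uncurry fun (q : E × E) (y : E) => K y q.2) (p, p.1) := by
    have h : ContDiffAt ℝ ∞ (fun r : (E × E) × E => (r.2, r.1.2)) (p, p.1) := by fun_prop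
    exact ContDiffAt.comp (p, p.1) (g := Function.uncurry K) hK h
  exact this.fderiv contDiffAt_fst (by simp)

variable [MeasurableSpace E] [BorelSpace E]

omit [FiniteDimensional ℝ E] [InnerProductSpace ℝ E] [MeasurableSpace E] [BorelSpace E] in
theorem ne_of_norm_lt_one {y : E} (hy : ‖y‖ < 1) (ζ : Metric.sphere (0 : E) 1) : y ≠ ζ := by
  intro h
  rw [h, norm_eq_of_mem_sphere] at hy
  exact lt_irrefl _ hy

omit [FiniteDimensional ℝ E] [MeasurableSpace E] [BorelSpace E] in
theorem continuous_kernel_sphere {K : E → E → F}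
    (hK : ∀ p : E × E, p.1 ≠ p.2 → ContDiffAt ℝ ∞ (Function.uncurry K) p)
    {x : E} (hx : ‖x‖ < 1) : Continuous fun ζ : Metric.sphere (0 : E) 1 => K x ζ := by
  rw [continuous_iff_continuousAt]
  intro ζ
  exact ContinuousAt.comp (g := Function.uncurry K)
    (f := fun ζ : Metric.sphere (0 : E) 1 => (x, (ζ : E)))
    (hK (x, ζ) (ne_of_norm_lt_one hx ζ)).continuousAt (by fun_prop)

theorem integrable_smul_kernel_sphere {K : E → E → F} {f : Metric.sphere (0 : E) 1 → ℝ} {M : ℝ}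
    (hK : ∀ p : E × E, p.1 ≠ p.2 → ContDiffAt ℝ ∞ (Function.uncurry K) p) (hf : Measurable f)
    (hM : ∀ ζ, |f ζ| ≤ M) {x : E} (hx : ‖x‖ < 1) :
    Integrable (fun ζ => f ζ • K x ζ) (surfaceMeasure E) := by
  have hcK := continuous_kernel_sphere hK hx
  obtain ⟨C, hC⟩ := isCompact_univ.exists_bound_of_continuousOn hcK.continuousOn
  refine Integrable.of_bound (hf.aestronglyMeasurable.smul hcK.aestronglyMeasurable) (M * C)
    (Eventually.of_forall fun ζ => ?_)
  rw [norm_smul]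
  exact mul_le_mul (hM ζ) (hC ζ (mem_univ _)) (norm_nonneg _) ((abs_nonneg _).trans (hM ζ))

/-- Differentiation of a kernel integral over the unit sphere. -/
theorem hasFDerivAt_integral_sphere {K : E → E → F} {f : Metric.sphere (0 : E) 1 → ℝ} {M : ℝ}
    (hK : ∀ p : E × E, p.1 ≠ p.2 → ContDiffAt ℝ ∞ (Function.uncurry K) p) (hf : Measurable f)
    (hM : ∀ ζ, |f ζ| ≤ M) {x : E} (hx : ‖x‖ < 1) :
    HasFDerivAt (fun y => ∫ ζ, f ζ • K y ζ ∂surfaceMeasure E)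
      (∫ ζ, f ζ • fderiv ℝ (fun y => K y ζ) x ∂surfaceMeasure E) x := by
  have hne : ∀ {y : E}, ‖y‖ < 1 → ∀ ζ : Metric.sphere (0 : E) 1, y ≠ ζ := ne_of_norm_lt_one
  set K' : E → E → E →L[ℝ] F := fun x ζ => fderiv ℝ (fun y => K y ζ) x with hK'
  have hK'c : ∀ p : E × E, p.1 ≠ p.2 → ContDiffAt ℝ ∞ (Function.uncurry K') p :=
    fun p hp => (hK p hp).uncurry_fderiv_left
  -- A closed ball inside the open unit ball: its product with the sphere is compact and misses the
  -- diagonal, which gives a uniform dominating bound.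
  obtain ⟨r, hr, hxr⟩ : ∃ r : ℝ, 0 < r ∧ ∀ y ∈ Metric.closedBall x r, ‖y‖ < 1 := by
    refine ⟨(1 - ‖x‖) / 2, by linarith, fun y hy => ?_⟩
    have h1 := norm_sub_norm_le y x
    rw [mem_closedBall_iff_norm] at hy
    linarith
  obtain ⟨B, hB⟩ : ∃ B, ∀ q ∈ Metric.closedBall x r ×ˢ Metric.sphere (0 : E) 1,
      ‖Function.uncurry K' q‖ ≤ B := by
    refine ((isCompact_closedBall x r).prod (isCompact_sphere 0 1)).exists_bound_of_continuousOn ?_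
    rintro ⟨y, ζ⟩ ⟨hy, hζ⟩
    exact (hK'c (y, ζ) (hne (hxr y hy) ⟨ζ, hζ⟩)).continuousAt.continuousWithinAt
  refine hasFDerivAt_integral_of_dominated_of_fderiv_le (𝕜 := ℝ) (bound := fun _ => M * B)
    (F' := fun y ζ => f ζ • K' y ζ)
    (Metric.closedBall_mem_nhds x hr) ?_ ?_ ?_ ?_ ?_ ?_
  · filter_upwards [Metric.closedBall_mem_nhds x hr] with y hy
    exact (integrable_smul_kernel_sphere hK hf hM (hxr y hy)).aestronglyMeasurable
  · exact integrable_smul_kernel_sphere hK hf hM hx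
  · exact (integrable_smul_kernel_sphere hK'c hf hM hx).aestronglyMeasurable
  · refine Eventually.of_forall fun ζ y hy => ?_
    rw [norm_smul]
    exact mul_le_mul (hM ζ) (hB (y, ζ) ⟨hy, ζ.2⟩) (norm_nonneg _) ((abs_nonneg _).trans (hM ζ))
  · exact integrable_const _
  · refine Eventually.of_forall fun ζ y hy => ?_
    have h1 : ContDiffAt ℝ ∞ (fun z => K z ζ) y :=
      ContDiffAt.comp (g := Function.uncurry K) (f := fun z : E => (z, (ζ : E))) y
        (hK (y, ζ) (hne (hxr y hy) ζ)) (by fun_prop)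
    exact ((h1.differentiableAt (by simp)).hasFDerivAt).const_smul (f ζ)

/-- Poisson integrals of bounded measurable functions are harmonic in the ball. -/
theorem harmonicOnNhd_integral_poissonKernelBall {f : Metric.sphere (0 : E) 1 → ℝ} {M : ℝ}
    (hf : Measurable f) (hM : ∀ ζ, |f ζ| ≤ M) :
    HarmonicOnNhd (fun y : E => ∫ ζ, f ζ * poissonKernelBall y (ζ : E) ∂surfaceMeasure E)
      (Metric.ball 0 1) := by
  set P : E → E → ℝ := poissonKernelBall
  have hP : ∀ p : E × E, p.1 ≠ p.2 → ContDiffAt ℝ ∞ (Function.uncurry P) p :=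
    fun p hp => contDiffAt_poissonKernelBall hp
  set P1 : E → E → E →L[ℝ] ℝ := fun x ζ => fderiv ℝ (fun y => P y ζ) x with hP1d
  have hP1 : ∀ p : E × E, p.1 ≠ p.2 → ContDiffAt ℝ ∞ (Function.uncurry P1) p :=
    fun p hp => (hP p hp).uncurry_fderiv_left
  set P2 : E → E → E →L[ℝ] E →L[ℝ] ℝ := fun x ζ => fderiv ℝ (fun y => P1 y ζ) x with hP2d
  have hP2 : ∀ p : E × E, p.1 ≠ p.2 → ContDiffAt ℝ ∞ (Function.uncurry P2) p :=
    fun p hp => (hP1 p hp).uncurry_fderiv_left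
  set u : E → ℝ := fun y => ∫ ζ, f ζ * P y ζ ∂surfaceMeasure E
  set u1 : E → E →L[ℝ] ℝ := fun y => ∫ ζ, f ζ • P1 y ζ ∂surfaceMeasure E
  set u2 : E → E →L[ℝ] E →L[ℝ] ℝ := fun y => ∫ ζ, f ζ • P2 y ζ ∂surfaceMeasure E
  have hu : ∀ y ∈ Metric.ball (0 : E) 1, HasFDerivAt u (u1 y) y := fun y hy =>
    hasFDerivAt_integral_sphere hP hf hM (mem_ball_zero_iff.1 hy)
  have hu1 : ∀ y ∈ Metric.ball (0 : E) 1, HasFDerivAt u1 (u2 y) y := fun y hy =>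
    hasFDerivAt_integral_sphere hP1 hf hM (mem_ball_zero_iff.1 hy)
  -- A third differentiation serves only to make the second derivative continuous, as `C²` requires.
  have hu2 : ∀ y ∈ Metric.ball (0 : E) 1, ContinuousAt u2 y := fun y hy =>
    (hasFDerivAt_integral_sphere hP2 hf hM (mem_ball_zero_iff.1 hy)).continuousAt
  have hnhds : ∀ y ∈ Metric.ball (0 : E) 1, Metric.ball (0 : E) 1 ∈ 𝓝 y := fun y hy =>
    Metric.isOpen_ball.mem_nhds hy
  have hC2 : ∀ y ∈ Metric.ball (0 : E) 1, ContDiffAt ℝ 2 u y := by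
    intro y hy
    have h0 : ContDiffAt ℝ 1 u1 y := by
      refine contDiffAt_one_iff.2 ⟨u2, _, hnhds y hy, fun z hz => (hu2 z hz).continuousWithinAt, hu1⟩
    exact (contDiffAt_succ_iff_hasFDerivAt (n := 1)).2 ⟨u1, ⟨_, hnhds y hy, hu⟩, h0⟩
  have hlap : ∀ y ∈ Metric.ball (0 : E) 1, Laplacian.laplacian u y = 0 := by
    intro y hy
    have hy1 : ‖y‖ < 1 := mem_ball_zero_iff.1 hy
    have hne := ne_of_norm_lt_one hy1
    have hfd : fderiv ℝ (fderiv ℝ u) y = u2 y := by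
      have : fderiv ℝ u =ᶠ[𝓝 y] u1 := by
        filter_upwards [hnhds y hy] with z hz using (hu z hz).fderiv
      rw [this.fderiv_eq]
      exact (hu1 y hy).fderiv
    have hint := integrable_smul_kernel_sphere hP2 hf hM hy1
    have happ : ∀ v : E, u2 y v v = ∫ ζ, f ζ * P2 y ζ v v ∂surfaceMeasure E := by
      intro v
      simp only [u2]
      rw [ContinuousLinearMap.integral_apply hint, ContinuousLinearMap.integral_apply]
      · simp
      · exact hint.apply_continuousLinearMap v
    have hint' : ∀ v : E, Integrable (fun ζ => f ζ * P2 y ζ v v) (surfaceMeasure E) := by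
      intro v
      simpa using (hint.apply_continuousLinearMap v).apply_continuousLinearMap v
    rw [laplacian_eq_sum_fderiv_fderiv (stdOrthonormalBasis ℝ E), hfd]
    simp only [happ]
    rw [← integral_finsetSum _ fun i _ => hint' _]
    refine integral_eq_zero_of_ae (Eventually.of_forall fun ζ => ?_)
    have h1 := laplacian_poissonKernelBall (hne ζ) (norm_eq_of_mem_sphere ζ)
    rw [laplacian_eq_sum_fderiv_fderiv (stdOrthonormalBasis ℝ E)] at h1
    simp only [Pi.zero_apply]
    rw [← Finset.mul_sum, ← mul_zero (f ζ)]
    exact congrArg _ h1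
  intro y hy
  refine ⟨hC2 y hy, ?_⟩
  filter_upwards [hnhds y hy] with z hz using hlap z hz

end PoissonIntegral

/-! ### Maximum principle, Poisson formula and the extremal function. -/

section HarmonicBounds

open scoped ENNReal ContDiff

variable {E : Type*} [NormedAddCommGroup E] [InnerProductSpace ℝ E]

theorem ContDiffAt.deriv_deriv_comp_line {f : E → ℝ} {x : E} (hf : ContDiffAt ℝ 2 f x) (v : E) :
    deriv (fun t : ℝ => f (x + t • v)) 0 = fderiv ℝ f x v ∧
      deriv (deriv fun t : ℝ => f (x + t • v)) 0 = fderiv ℝ (fderiv ℝ f) x v v := by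
  have hline : ∀ t : ℝ, HasDerivAt (fun t : ℝ => x + t • v) v t := fun t => by
    simpa using ((hasDerivAt_id t).smul_const v).const_add x
  have hx0 : x + (0 : ℝ) • v = x := by simp
  have hev : ∀ᶠ y in 𝓝 x, DifferentiableAt ℝ f y := by
    filter_upwards [hf.eventually (by simp)] with y hy using hy.differentiableAt (by simp)
  have hcont : Tendsto (fun t : ℝ => x + t • v) (𝓝 0) (𝓝 x) := by
    conv_rhs => rw [← hx0]
    exact (hline 0).continuousAt
  have h1 : (deriv fun t : ℝ => f (x + t • v)) =ᶠ[𝓝 0] fun t => fderiv ℝ f (x + t • v) v := by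
    filter_upwards [hcont.eventually hev] with t ht
    exact (ht.hasFDerivAt.comp_hasDerivAt t (hline t)).deriv
  refine ⟨by simpa using h1.eq_of_nhds, ?_⟩
  rw [h1.deriv_eq]
  have h2 : HasFDerivAt (fderiv ℝ f) (fderiv ℝ (fderiv ℝ f) x) (x + (0 : ℝ) • v) := by
    rw [hx0]
    exact ((hf.fderiv_right (m := 1) (by norm_num)).differentiableAt (by simp)).hasFDerivAt
  have h3 := h2.comp_hasDerivAt (0 : ℝ) (hline 0)
  have h4 := (ContinuousLinearMap.apply ℝ ℝ v).hasFDerivAt.comp_hasDerivAt (0 : ℝ) h3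
  exact h4.deriv

/-- The second derivative test: at a local maximum pure second derivatives are nonpositive. -/
theorem IsLocalMax.fderiv_fderiv_nonpos {f : E → ℝ} {x : E} (h : IsLocalMax f x)
    (hf : ContDiffAt ℝ 2 f x) (v : E) : fderiv ℝ (fderiv ℝ f) x v v ≤ 0 := by
  obtain ⟨h1, h2⟩ := hf.deriv_deriv_comp_line v
  by_contra! hpos
  set g : ℝ → ℝ := fun t => f (x + t • v) with hg
  have hline : ContinuousAt (fun t : ℝ => x + t • v) 0 := by fun_prop
  have hx0 : x + (0 : ℝ) • v = x := by simp
  have hgc : ContinuousAt g 0 :=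
    ContinuousAt.comp (g := f) (by rw [hx0]; exact hf.continuousAt) hline
  have hmax : IsLocalMax g 0 := by
    have h' : ∀ᶠ y in 𝓝 (x + (0 : ℝ) • v), f y ≤ f (x + (0 : ℝ) • v) := by rw [hx0]; exact h
    exact hline.eventually h'
  -- A positive second derivative would make `0` a local minimum as well, hence `g` locally constant
  -- with zero second derivative.
  have hmin : IsLocalMin g 0 :=
    isLocalMin_of_deriv_deriv_pos (by rw [h2]; exact hpos) hmax.deriv_eq_zero hgc
  have hconst : g =ᶠ[𝓝 0] fun _ => g 0 := by
    filter_upwards [hmax, hmin] with t ht1 ht2 using le_antisymm ht1 ht2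
  have h3 : deriv g =ᶠ[𝓝 0] fun _ => 0 := by
    have := hconst.deriv
    simpa using this
  have h4 := h3.deriv_eq
  simp only [deriv_const] at h4
  rw [h4] at h2
  exact hpos.ne h2

variable [FiniteDimensional ℝ E]

/-- The weak maximum principle on the unit ball. -/
theorem nonpos_of_harmonicOnNhd_of_sphere_nonpos [Nontrivial E] {w : E → ℝ}
    (hc : ContinuousOn w (Metric.closedBall 0 1)) (hh : HarmonicOnNhd w (Metric.ball 0 1))
    (hb : ∀ ζ : E, ‖ζ‖ = 1 → w ζ ≤ 0) {x : E} (hx : x ∈ Metric.ball (0 : E) 1) : w x ≤ 0 := by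
  by_contra! hpos
  have hx1 : ‖x‖ < 1 := mem_ball_zero_iff.1 hx
  -- With this `ε`, `g = w + ε‖·‖²` is at most `w x / 2` on the sphere and at least `w x` at `x`.
  -- Its maximum is therefore interior, where its Laplacian `2 * ε * n > 0` contradicts the second
  -- derivative test.
  set ε : ℝ := w x / 2 with hε
  have hεp : 0 < ε := by positivity
  set g : E → ℝ := w + fun y => ε * ‖y‖ ^ 2 with hg
  have hgc : ContinuousOn g (Metric.closedBall 0 1) := hc.add (by fun_prop)
  obtain ⟨y, hy, hmax⟩ := (isCompact_closedBall (0 : E) 1).exists_isMaxOn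
    ⟨x, Metric.ball_subset_closedBall hx⟩ hgc
  have hgx : g x ≤ g y := hmax (Metric.ball_subset_closedBall hx)
  have hy1 : ‖y‖ < 1 := by
    refine lt_of_le_of_ne (mem_closedBall_zero_iff.1 hy) fun hy1 => ?_
    have := hb y hy1
    simp only [hg, Pi.add_apply, hy1] at hgx
    nlinarith [mul_nonneg hεp.le (sq_nonneg ‖x‖)]
  have hyb : y ∈ Metric.ball (0 : E) 1 := mem_ball_zero_iff.2 hy1
  have hloc : IsLocalMax g y :=
    (hmax.on_subset Metric.ball_subset_closedBall).isLocalMax (Metric.isOpen_ball.mem_nhds hyb)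
  have hsq : ContDiff ℝ 2 fun y : E => ε * ‖y‖ ^ 2 := contDiff_const.mul (contDiff_norm_sq ℝ)
  have hw := (hh y hyb).1
  have hgd : ContDiffAt ℝ 2 g y := hw.add hsq.contDiffAt
  have h1 : Laplacian.laplacian g y ≤ 0 := by
    rw [laplacian_eq_sum_fderiv_fderiv (stdOrthonormalBasis ℝ E)]
    exact Finset.sum_nonpos fun i _ => hloc.fderiv_fderiv_nonpos hgd _
  have h2 : Laplacian.laplacian g y = 2 * ε * finrank ℝ E := by
    rw [hg, hw.laplacian_add hsq.contDiffAt, (hh y hyb).2.eq_of_nhds, Pi.zero_apply, zero_add,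
      laplacian_eq_sum_fderiv_fderiv (stdOrthonormalBasis ℝ E)]
    have h3 : (fderiv ℝ fun y : E => ε * ‖y‖ ^ 2) = fun y => (2 * ε) • innerSL ℝ y := by
      ext z v
      rw [(((hasStrictFDerivAt_norm_sq z).hasFDerivAt).const_mul ε).fderiv]
      simp
      ring
    have h4 : ∀ z : E, fderiv ℝ (fun y : E => ((2 * ε) • innerSL ℝ y : E →L[ℝ] ℝ)) z =
        (2 * ε) • (innerSL ℝ : E →L[ℝ] E →L[ℝ] ℝ) := fun z =>
      ((innerSL ℝ : E →L[ℝ] E →L[ℝ] ℝ).hasFDerivAt.const_smul (2 * ε)).fderiv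
    have h5 : ∀ v : E, (innerSL ℝ : E →L[ℝ] E →L[ℝ] ℝ) v v = ‖v‖ ^ 2 :=
      fun v => real_inner_self_eq_norm_sq v
    rw [h3, h4]
    simp only [smul_apply, h5, OrthonormalBasis.norm_eq_one, smul_eq_mul]
    simp
    ring
  have hn : (0 : ℝ) < finrank ℝ E := by exact_mod_cast finrank_pos
  have : 0 < 2 * ε * finrank ℝ E := by positivity
  linarith

variable [MeasurableSpace E] [BorelSpace E]

omit [FiniteDimensional ℝ E] [MeasurableSpace E] [BorelSpace E] in
theorem poissonKernelBall_nonneg {x : E} (hx : ‖x‖ < 1) (ζ : E) : 0 ≤ poissonKernelBall x ζ := by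
  have hx' : 0 < 1 - ‖x‖ ^ 2 := by nlinarith [norm_nonneg x]
  unfold poissonKernelBall
  positivity

theorem integrable_poissonKernelBall {x : E} (hx : ‖x‖ < 1) :
    Integrable (fun ζ : Metric.sphere (0 : E) 1 => poissonKernelBall x (ζ : E)) (surfaceMeasure E) := by
  simpa using integrable_smul_kernel_sphere (f := fun _ => 1) (M := 1)
    (fun p hp => contDiffAt_poissonKernelBall hp) measurable_const (by simp) hx

theorem integral_poissonKernelBall [Nontrivial E] {x : E} (hx : ‖x‖ < 1) :
    ∫ ζ, poissonKernelBall x ζ ∂surfaceMeasure E = (surfaceMeasure E).real univ := by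
  rw [integral_eq_lintegral_of_nonneg_ae
    (Eventually.of_forall fun ζ : Metric.sphere (0 : E) 1 => poissonKernelBall_nonneg hx (ζ : E))
    (integrable_poissonKernelBall hx).aestronglyMeasurable, lintegral_poissonKernelBall hx]
  rfl

theorem surfaceMeasure_real_univ_pos [Nontrivial E] : 0 < (surfaceMeasure E).real univ :=
  have : NeZero (surfaceMeasure E) := ⟨Measure.toSphere_ne_zero _⟩
  measureReal_univ_pos

/-- Poisson integrals of continuous functions attain their boundary values. -/
theorem tendsto_integral_poissonKernelBall [Nontrivial E] {g : Metric.sphere (0 : E) 1 → ℝ}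
    (hg : Continuous g) (ζ₀ : Metric.sphere (0 : E) 1) :
    Tendsto (fun y : E => ((surfaceMeasure E).real univ)⁻¹ *
        ∫ ζ, g ζ * poissonKernelBall y (ζ : E) ∂surfaceMeasure E)
      (𝓝[Metric.ball 0 1] (ζ₀ : E)) (𝓝 (g ζ₀)) := by
  have hσ := surfaceMeasure_real_univ_pos (E := E)
  set s : ℝ := (surfaceMeasure E).real univ with hs
  have hball : ∀ᶠ y in 𝓝[Metric.ball 0 1] (ζ₀ : E), ‖y‖ < 1 := by
    filter_upwards [self_mem_nhdsWithin] with y hy using mem_ball_zero_iff.1 hy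
  obtain ⟨C, hC⟩ := isCompact_univ.exists_bound_of_continuousOn hg.continuousOn
  have hgi : Integrable g (surfaceMeasure E) :=
    Integrable.of_bound hg.aestronglyMeasurable C (Eventually.of_forall fun ζ => hC ζ (mem_univ _))
  have key := tendsto_integral_peak_smul_of_integrable_of_tendsto (μ := surfaceMeasure E)
    (φ := fun (y : E) (ζ : Metric.sphere (0 : E) 1) => s⁻¹ * poissonKernelBall y (ζ : E))
    (l := 𝓝[Metric.ball 0 1] (ζ₀ : E)) (x₀ := ζ₀) (g := g) (a := g ζ₀)
    MeasurableSet.univ univ_mem (measure_ne_top _ _) ?_ ?_ ?_ ?_ hgi hg.continuousAt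
  · refine key.congr fun y => ?_
    rw [← integral_const_mul]
    refine integral_congr_ae (Eventually.of_forall fun ζ => ?_)
    simp only [smul_eq_mul]
    ring
  · filter_upwards [hball] with y hy ζ
    exact mul_nonneg (inv_nonneg.2 hσ.le) (poissonKernelBall_nonneg hy ζ)
  · intro u hu hζu
    obtain ⟨δ, hδ, hδu⟩ := Metric.isOpen_iff.1 hu ζ₀ hζu
    rw [Metric.tendstoUniformlyOn_iff]
    intro ε hε
    -- For `y` within `δ / 2` of `ζ₀` and `ζ` at distance at least `δ` from it, `‖y - ζ‖ ≥ δ / 2`;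
    -- the kernel is then bounded by this quantity, uniformly in `ζ`.
    have hlim : Tendsto (fun y : E => s⁻¹ * ((1 - ‖y‖ ^ 2) / (δ / 2) ^ finrank ℝ E))
        (𝓝[Metric.ball 0 1] (ζ₀ : E)) (𝓝 0) := by
      have hc : Continuous fun y : E => s⁻¹ * ((1 - ‖y‖ ^ 2) / (δ / 2) ^ finrank ℝ E) := by fun_prop
      have := hc.tendsto (ζ₀ : E)
      simp only [norm_eq_of_mem_sphere, one_pow, sub_self, zero_div, mul_zero] at this
      exact this.mono_left nhdsWithin_le_nhds
    filter_upwards [hball, hlim.eventually (gt_mem_nhds hε),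
      nhdsWithin_le_nhds (Metric.ball_mem_nhds (ζ₀ : E) (half_pos hδ))] with y hy hyε hyδ ζ hζ
    have h1 : δ ≤ dist (ζ : E) ζ₀ := by
      by_contra! h
      exact hζ (hδu h)
    have h2 : δ / 2 ≤ ‖y - ζ‖ := by
      have := dist_triangle (ζ : E) y ζ₀
      have h3 : dist y (ζ₀ : E) < δ / 2 := hyδ
      rw [← dist_eq_norm, dist_comm]
      linarith
    have hx' : 0 < 1 - ‖y‖ ^ 2 := by nlinarith [norm_nonneg y]
    rw [Pi.zero_apply, dist_zero_left, Real.norm_eq_abs,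
      abs_of_nonneg (mul_nonneg (inv_nonneg.2 hσ.le) (poissonKernelBall_nonneg hy ζ))]
    refine lt_of_le_of_lt ?_ hyε
    unfold poissonKernelBall
    gcongr
  · refine tendsto_const_nhds.congr' ?_
    filter_upwards [hball] with y hy
    rw [setIntegral_univ, integral_const_mul, integral_poissonKernelBall hy, inv_mul_cancel₀ hσ.ne']
  · filter_upwards [hball] with y hy
    exact ((integrable_poissonKernelBall hy).const_mul _).aestronglyMeasurable

/-- The Poisson formula. -/
theorem HarmonicOnNhd.eq_integral_poissonKernelBall [Nontrivial E] {v : E → ℝ}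
    (hc : ContinuousOn v (Metric.closedBall 0 1)) (hh : HarmonicOnNhd v (Metric.ball 0 1)) {x : E}
    (hx : x ∈ Metric.ball (0 : E) 1) :
    v x = ((surfaceMeasure E).real univ)⁻¹ *
      ∫ ζ, v ζ * poissonKernelBall x ζ ∂surfaceMeasure E := by
  have hgc : Continuous fun ζ : Metric.sphere (0 : E) 1 => v ζ := by
    refine hc.comp_continuous continuous_subtype_val fun ζ => ?_
    exact Metric.sphere_subset_closedBall ζ.2
  obtain ⟨C, hC⟩ := isCompact_univ.exists_bound_of_continuousOn hgc.continuousOn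
  set I : E → ℝ := fun y => ((surfaceMeasure E).real univ)⁻¹ *
      ∫ ζ, v ζ * poissonKernelBall y ζ ∂surfaceMeasure E with hI
  have hIh : HarmonicOnNhd I (Metric.ball 0 1) :=
    (harmonicOnNhd_integral_poissonKernelBall hgc.measurable fun ζ => hC ζ (mem_univ _)).const_smul
  have hd : HarmonicOnNhd (v - I) (Metric.ball 0 1) := hh.sub hIh
  -- `I` has the right boundary values only as a limit from inside, so the difference is reset to
  -- zero on the sphere, which makes it continuous on the closed ball.
  set w : E → ℝ := (Metric.ball 0 1).indicator (v - I) with hw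
  have hwe : ∀ y ∈ Metric.ball (0 : E) 1, w =ᶠ[𝓝 y] v - I := fun y hy => by
    filter_upwards [Metric.isOpen_ball.mem_nhds hy] with z hz using indicator_of_mem hz _
  have hwh : HarmonicOnNhd w (Metric.ball 0 1) := fun y hy =>
    (harmonicAt_congr_nhds (hwe y hy)).2 (hd y hy)
  have hws : ∀ ζ : E, ‖ζ‖ = 1 → w ζ = 0 := fun ζ hζ =>
    indicator_of_notMem (by simp [hζ]) _
  have hwc : ContinuousOn w (Metric.closedBall 0 1) := by
    intro y hy
    rcases (mem_closedBall_zero_iff.1 hy).lt_or_eq with hy1 | hy1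
    · exact (hwh y (mem_ball_zero_iff.2 hy1)).1.continuousAt.continuousWithinAt
    · have hys : y ∈ Metric.sphere (0 : E) 1 := mem_sphere_zero_iff_norm.2 hy1
      rw [ContinuousWithinAt, hws y hy1, ← Metric.ball_union_sphere, nhdsWithin_union, tendsto_sup]
      constructor
      · have h1 := (hc y hy).mono_left (nhdsWithin_mono y Metric.ball_subset_closedBall)
        have h2 := h1.sub (tendsto_integral_poissonKernelBall hgc ⟨y, hys⟩)
        rw [sub_self] at h2
        refine h2.congr' ?_
        filter_upwards [self_mem_nhdsWithin] with z hz
        rw [hw, indicator_of_mem hz]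
        rfl
      · refine tendsto_const_nhds.congr' ?_
        filter_upwards [self_mem_nhdsWithin] with z hz
        rw [hws z (mem_sphere_zero_iff_norm.1 hz)]
  have h1 := nonpos_of_harmonicOnNhd_of_sphere_nonpos hwc hwh (fun ζ hζ => (hws ζ hζ).le) hx
  have h2 := nonpos_of_harmonicOnNhd_of_sphere_nonpos hwc.neg hwh.neg
    (fun ζ hζ => by simp [hws ζ hζ]) hx
  have h3 : w x = 0 := le_antisymm h1 (by simpa using h2)
  rw [hw, indicator_of_mem hx] at h3
  exact sub_eq_zero.1 h3

omit [MeasurableSpace E] [BorelSpace E] in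
-- For `r < 1` dilation makes a function harmonic only in the open ball harmonic up to the sphere,
-- so that the Poisson formula applies.
theorem harmonicAt_comp_smul {u : E → ℝ} {x : E} {r : ℝ} (h : HarmonicAt u (r • x)) :
    HarmonicAt (fun y => u (r • y)) x := by
  have hs : ∀ y : E, HasFDerivAt (fun y : E => r • y) (r • ContinuousLinearMap.id ℝ E) y := fun y =>
    (hasFDerivAt_id y).const_smul r
  have ht : Tendsto (fun y : E => r • y) (𝓝 x) (𝓝 (r • x)) := (hs x).continuousAt
  refine ⟨ContDiffAt.comp (g := u) x h.1 (by fun_prop), ?_⟩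
  filter_upwards [ht.eventually h.2, ht.eventually (h.1.eventually (by simp))] with y hy hy2
  have h1 : (fderiv ℝ fun y => u (r • y)) =ᶠ[𝓝 y] fun z => r • fderiv ℝ u (r • z) := by
    filter_upwards [(hs y).continuousAt.eventually (hy2.eventually (by simp))] with z hz
    have := ((hz.differentiableAt (by simp)).hasFDerivAt).comp z (hs z)
    rw [show (fun y => u (r • y)) = u ∘ HSMul.hSMul r from rfl, this.fderiv]
    ext v
    simp
  have h2 : HasFDerivAt (fun z => r • fderiv ℝ u (r • z))
      (r • (fderiv ℝ (fderiv ℝ u) (r • y)).comp (r • ContinuousLinearMap.id ℝ E)) y :=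
    ((((hy2.fderiv_right (m := 1) (by norm_num)).differentiableAt (by simp)).hasFDerivAt).comp y
      (hs y)).const_smul r
  rw [laplacian_eq_sum_fderiv_fderiv (stdOrthonormalBasis ℝ E)] at hy ⊢
  rw [h1.fderiv_eq, h2.fderiv]
  simp only [smul_apply, ContinuousLinearMap.comp_apply, map_smul,
    ContinuousLinearMap.id_apply, smul_eq_mul, ← Finset.mul_sum, Pi.zero_apply]
  simp only [Pi.zero_apply] at hy
  rw [hy, mul_zero, mul_zero]

theorem integrable_fderiv_poissonKernelBall {f : Metric.sphere (0 : E) 1 → ℝ} {M : ℝ}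
    (hf : Measurable f) (hM : ∀ ζ, |f ζ| ≤ M) {x : E} (hx : ‖x‖ < 1) (l : E) :
    Integrable (fun ζ => f ζ * fderiv ℝ (fun y => poissonKernelBall y (ζ : E)) x l)
      (surfaceMeasure E) := by
  have h := (integrable_smul_kernel_sphere
    (fun p hp => (contDiffAt_poissonKernelBall hp).uncurry_fderiv_left) hf hM hx)
  simpa using h.apply_continuousLinearMap l

theorem fderiv_integral_poissonKernelBall {f : Metric.sphere (0 : E) 1 → ℝ} {M : ℝ}
    (hf : Measurable f) (hM : ∀ ζ, |f ζ| ≤ M) {x : E} (hx : ‖x‖ < 1) (l : E) :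
    fderiv ℝ (fun y => ((surfaceMeasure E).real univ)⁻¹ *
        ∫ ζ, f ζ * poissonKernelBall y (ζ : E) ∂surfaceMeasure E) x l =
      ((surfaceMeasure E).real univ)⁻¹ *
        ∫ ζ, f ζ * fderiv ℝ (fun y => poissonKernelBall y (ζ : E)) x l ∂surfaceMeasure E := by
  have h := (hasFDerivAt_integral_sphere (fun p hp => contDiffAt_poissonKernelBall hp) hf hM
    hx).const_mul (((surfaceMeasure E).real univ)⁻¹)
  simp only [smul_eq_mul] at h
  rw [h.fderiv, smul_apply, ContinuousLinearMap.integral_apply]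
  · simp
  · exact integrable_smul_kernel_sphere
      (fun p hp => (contDiffAt_poissonKernelBall hp).uncurry_fderiv_left) hf hM hx

theorem abs_fderiv_le_of_harmonicOnNhd_closedBall [Nontrivial E] {v : E → ℝ} {M : ℝ}
    (hc : ContinuousOn v (Metric.closedBall 0 1)) (hh : HarmonicOnNhd v (Metric.ball 0 1))
    (hM : ∀ ζ : E, ‖ζ‖ = 1 → |v ζ| ≤ M) {x : E} (hx : ‖x‖ < 1) (l : E) :
    |fderiv ℝ v x l| ≤ (((surfaceMeasure E).real univ)⁻¹ *
      ∫ ζ, |fderiv ℝ (fun y => poissonKernelBall y (ζ : E)) x l| ∂surfaceMeasure E) * M := by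
  have hgc : Continuous fun ζ : Metric.sphere (0 : E) 1 => v ζ := by
    refine hc.comp_continuous continuous_subtype_val fun ζ => ?_
    exact Metric.sphere_subset_closedBall ζ.2
  have hM' : ∀ ζ : Metric.sphere (0 : E) 1, |v ζ| ≤ M := fun ζ => hM ζ (norm_eq_of_mem_sphere ζ)
  have hev : v =ᶠ[𝓝 x] fun y => ((surfaceMeasure E).real univ)⁻¹ *
      ∫ ζ, v ζ * poissonKernelBall y (ζ : E) ∂surfaceMeasure E := by
    filter_upwards [Metric.isOpen_ball.mem_nhds (mem_ball_zero_iff.2 hx)] with y hy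
    exact HarmonicOnNhd.eq_integral_poissonKernelBall hc hh hy
  have hσ := surfaceMeasure_real_univ_pos (E := E)
  have hi1 := integrable_fderiv_poissonKernelBall (f := fun _ => 1) measurable_const (M := 1)
    (by simp) hx l
  simp only [one_mul] at hi1
  rw [hev.fderiv_eq, fderiv_integral_poissonKernelBall hgc.measurable hM' hx, abs_mul, abs_inv,
    abs_of_pos hσ, mul_assoc]
  gcongr
  rw [← integral_mul_const]
  refine (abs_integral_le_integral_abs).trans ?_
  refine integral_mono (integrable_fderiv_poissonKernelBall hgc.measurable hM' hx l).abs
    (hi1.abs.mul_const M) fun ζ => ?_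
  simp only [abs_mul]
  rw [mul_comm]
  gcongr
  exact hM' ζ

/-- The gradient estimate for bounded harmonic functions on the ball. -/
theorem abs_fderiv_le_of_harmonicOnNhd_ball [Nontrivial E] {u : E → ℝ} {M : ℝ}
    (hh : HarmonicOnNhd u (Metric.ball 0 1))
    (hM : ∀ y ∈ Metric.ball (0 : E) 1, |u y| ≤ M) {x : E} (hx : ‖x‖ < 1) (l : E) :
    |fderiv ℝ u x l| ≤ (((surfaceMeasure E).real univ)⁻¹ *
      ∫ ζ, |fderiv ℝ (fun y => poissonKernelBall y (ζ : E)) x l| ∂surfaceMeasure E) * M := by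
  have hxb : x ∈ Metric.ball (0 : E) 1 := mem_ball_zero_iff.2 hx
  -- The factor `r` comes from the chain rule for `u (r • ·)`; the bound for each `r < 1` passes to
  -- the limit.
  have hcl : ContinuousAt (fun r : ℝ => |r * fderiv ℝ u (r • x) l|) 1 := by
    have h1 : ContinuousAt (fderiv ℝ u) ((1 : ℝ) • x) := by
      rw [one_smul]
      exact ((hh x hxb).1.fderiv_right (m := 1) (by norm_num)).continuousAt
    have h2 : ContinuousAt (fun r : ℝ => fderiv ℝ u (r • x)) 1 :=
      ContinuousAt.comp (g := fderiv ℝ u) (f := fun r : ℝ => r • x) h1 (by fun_prop)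
    exact (continuousAt_id.mul (h2.clm_apply continuousAt_const)).abs
  have hlim : Tendsto (fun r : ℝ => |r * fderiv ℝ u (r • x) l|) (𝓝[<] 1) (𝓝 |fderiv ℝ u x l|) := by
    have := hcl.tendsto.mono_left (nhdsWithin_le_nhds (s := Iio 1))
    simpa using this
  refine le_of_tendsto hlim ?_
  have h01 : Ioo (0 : ℝ) 1 ∈ 𝓝[<] (1 : ℝ) := Ioo_mem_nhdsLT one_pos
  filter_upwards [h01] with r hr
  have hmem : ∀ y : E, ‖y‖ ≤ 1 → r • y ∈ Metric.ball (0 : E) 1 := fun y hy => by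
    rw [mem_ball_zero_iff, norm_smul, Real.norm_eq_abs, abs_of_pos hr.1]
    nlinarith [hr.1, hr.2]
  have hH : ∀ y : E, ‖y‖ ≤ 1 → HarmonicAt (fun y => u (r • y)) y := fun y hy =>
    harmonicAt_comp_smul (hh _ (hmem y hy))
  have h1 := abs_fderiv_le_of_harmonicOnNhd_closedBall (v := fun y => u (r • y)) (M := M)
    (fun y hy => (hH y (mem_closedBall_zero_iff.1 hy)).1.continuousAt.continuousWithinAt)
    (fun y hy => hH y (mem_ball_zero_iff.1 hy).le)
    (fun ζ hζ => hM _ (hmem ζ hζ.le)) hx l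
  have h2 : HasFDerivAt (fun y => u (r • y))
      ((fderiv ℝ u (r • x)).comp (r • ContinuousLinearMap.id ℝ E)) x :=
    HasFDerivAt.comp (g := u) x
      (((hh _ (hmem x hx.le)).1.differentiableAt (by simp)).hasFDerivAt)
      ((hasFDerivAt_id x).const_smul r)
  rw [h2.fderiv] at h1
  simpa using h1

/-- The gradient estimate is attained by a Poisson integral of a sign function. -/
theorem exists_harmonicOnNhd_fderiv_eq [Nontrivial E] {x : E} (hx : ‖x‖ < 1) (l : E) :
    ∃ u : E → ℝ, HarmonicOnNhd u (Metric.ball 0 1) ∧ (∀ y ∈ Metric.ball (0 : E) 1, |u y| ≤ 1) ∧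
      fderiv ℝ u x l = ((surfaceMeasure E).real univ)⁻¹ *
        ∫ ζ, |fderiv ℝ (fun y => poissonKernelBall y (ζ : E)) x l| ∂surfaceMeasure E := by
  have hσ := surfaceMeasure_real_univ_pos (E := E)
  set D : Metric.sphere (0 : E) 1 → ℝ := fun ζ => fderiv ℝ (fun y => poissonKernelBall y (ζ : E)) x l
    with hD
  have hDc : Continuous D := (continuous_kernel_sphere
    (fun p hp => (contDiffAt_poissonKernelBall hp).uncurry_fderiv_left) hx).clm_apply
      continuous_const
  set f : Metric.sphere (0 : E) 1 → ℝ := fun ζ => if 0 ≤ D ζ then 1 else -1 with hf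
  have hfm : Measurable f := Measurable.ite (measurableSet_le measurable_const hDc.measurable)
    measurable_const measurable_const
  have hf1 : ∀ ζ, |f ζ| ≤ 1 := fun ζ => by
    simp only [hf]
    split_ifs <;> simp
  have hfD : ∀ ζ, f ζ * D ζ = |D ζ| := fun ζ => by
    simp only [hf]
    split_ifs with h
    · rw [one_mul, abs_of_nonneg h]
    · rw [neg_one_mul, abs_of_neg (not_le.1 h)]
  refine ⟨fun y => ((surfaceMeasure E).real univ)⁻¹ *
    ∫ ζ, f ζ * poissonKernelBall y (ζ : E) ∂surfaceMeasure E, ?_, ?_, ?_⟩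
  · exact (harmonicOnNhd_integral_poissonKernelBall hfm hf1).const_smul
  · intro y hy
    have hy1 := mem_ball_zero_iff.1 hy
    rw [abs_mul, abs_inv, abs_of_pos hσ, inv_mul_le_iff₀ hσ, mul_one,
      ← integral_poissonKernelBall hy1]
    refine (abs_integral_le_integral_abs).trans ?_
    have hfi : Integrable (fun ζ => f ζ * poissonKernelBall y (ζ : E)) (surfaceMeasure E) :=
      integrable_smul_kernel_sphere (fun p hp => contDiffAt_poissonKernelBall hp) hfm hf1 hy1
    refine integral_mono hfi.abs (integrable_poissonKernelBall hy1) fun ζ => ?_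
    simp only [abs_mul, abs_of_nonneg (poissonKernelBall_nonneg hy1 (ζ : E))]
    exact mul_le_of_le_one_left (poissonKernelBall_nonneg hy1 _) (hf1 ζ)
  · rw [fderiv_integral_poissonKernelBall hfm hf1 hx]
    congr 1
    exact integral_congr_ae (Eventually.of_forall hfD)

end HarmonicBounds

/-- Duality between `L^∞` and `L¹`: the Poisson formula bounds the derivative by the `L¹` norm of
the differentiated kernel, and sign boundary data attain it. -/
theorem isSharpConstant_poissonKernelBall {n : ℕ} [NeZero n] {x : EuclideanSpace ℝ (Fin n)}
    (hx : ‖x‖ < 1) (l : EuclideanSpace ℝ (Fin n)) :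
    IsSharpConstant x l (((surfaceMeasure (EuclideanSpace ℝ (Fin n))).real univ)⁻¹ *
      ∫ ζ, |fderiv ℝ (fun y => poissonKernelBall y (ζ : EuclideanSpace ℝ (Fin n))) x l|
        ∂surfaceMeasure (EuclideanSpace ℝ (Fin n))) := by
  have hgrad : ∀ u : EuclideanSpace ℝ (Fin n) → ℝ, ⟪∇ u x, l⟫ = fderiv ℝ u x l := fun u => by
    rw [gradient, toDual_symm_apply]
  have h0 : (0 : EuclideanSpace ℝ (Fin n)) ∈ Metric.ball 0 1 := Metric.mem_ball_self one_pos
  constructor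
  · intro u hu hb
    rw [hgrad]
    exact abs_fderiv_le_of_harmonicOnNhd_ball hu (fun y hy => le_csSup hb ⟨y, hy, rfl⟩) hx l
  · intro C hC
    obtain ⟨u, hu, hu1, hul⟩ := exists_harmonicOnNhd_fderiv_eq hx l
    -- The extremal function is only known to satisfy `sup |u| ≤ 1`, so replacing the supremum by
    -- `1` needs `C ≥ 0`; testing on a constant function supplies it.
    have hC0 : 0 ≤ C := by
      have h := hC (fun _ => 1) (harmonicOnNhd_const 1) ⟨1, by rintro _ ⟨y, -, rfl⟩; simp⟩
      have h1 : (fun y : EuclideanSpace ℝ (Fin n) => |(1 : ℝ)|) '' Metric.ball 0 1 = {1} := by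
        rw [abs_one]; exact (Set.nonempty_of_mem h0).image_const 1
      rw [h1, csSup_singleton, mul_one] at h
      exact (abs_nonneg _).trans h
    have hbd : BddAbove ((fun y => |u y|) '' Metric.ball 0 1) :=
      ⟨1, by rintro _ ⟨y, hy, rfl⟩; exact hu1 y hy⟩
    have h := hC u hu hbd
    rw [hgrad, hul] at h
    refine (le_abs_self _).trans (h.trans ?_)
    refine mul_le_of_le_one_right hC0 (csSup_le ⟨_, 0, h0, rfl⟩ ?_)
    rintro _ ⟨y, hy, rfl⟩
    exact hu1 y hy

/-! ### Spherical averages of powers of affine functions. -/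

section HypergeometricAverage

open scoped ENNReal Nat

theorem hasSum_one_sub_rpow_neg (s : ℝ) {y : ℝ} (hy : |y| < 1) :
    HasSum (fun k : ℕ => ((k ! : ℝ)⁻¹ * (ascPochhammer ℝ k).eval s) * y ^ k) ((1 - y) ^ (-s)) := by
  have h := (Real.one_div_one_sub_rpow_hasFPowerSeriesOnBall_zero s).hasSum (y := y)
    (by rw [Metric.mem_eball, edist_zero_right, Real.enorm_eq_ofReal_abs]
        exact ENNReal.ofReal_lt_one.2 hy)
  have hy' : 0 ≤ 1 - y := by linarith [(abs_lt.1 hy).2]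
  rw [zero_add, one_div, ← Real.rpow_neg hy'] at h
  refine h.congr_fun fun k => ?_
  rw [FormalMultilinearSeries.ofScalars_apply_eq, smul_eq_mul]
  congr 1
  have hk : (k ! : ℝ) ≠ 0 := by positivity
  have h1 := Ring.factorial_nsmul_multichoose_eq_ascPochhammer s k
  rw [Polynomial.ascPochhammer_smeval_eq_eval, nsmul_eq_mul] at h1
  rw [Ring.choose, show s + k - 1 - k + 1 = s by ring, ← h1, inv_mul_cancel_left₀ hk]

theorem Real.Gamma_nat_add {x : ℝ} (hx : 0 < x) (k : ℕ) :
    Real.Gamma (k + x) = (ascPochhammer ℝ k).eval x * Real.Gamma x := by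
  induction k with
  | zero => simp
  | succ k ih =>
    have hkx : (k : ℝ) + x ≠ 0 := by positivity
    rw [ascPochhammer_succ_eval, show ((k + 1 : ℕ) : ℝ) + x = (k + x) + 1 by push_cast; ring,
      Real.Gamma_add_one hkx, ih]
    ring

/-- Splitting the even and odd factors is what produces the two upper parameters `s / 2` and `(s +
1) / 2` of the `₂F₁`. -/
theorem ascPochhammer_eval_two_mul (s : ℝ) (k : ℕ) :
    (ascPochhammer ℝ (2 * k)).eval s =
      4 ^ k * ((ascPochhammer ℝ k).eval (s / 2) * (ascPochhammer ℝ k).eval ((s + 1) / 2)) := by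
  induction k with
  | zero => simp
  | succ k ih =>
    rw [show 2 * (k + 1) = 2 * k + 1 + 1 by ring, ascPochhammer_succ_eval, ascPochhammer_succ_eval,
      ih, ascPochhammer_succ_eval, ascPochhammer_succ_eval]
    push_cast
    ring

theorem factorial_two_mul_eq_ascPochhammer (k : ℕ) :
    ((2 * k)! : ℝ) = 4 ^ k * (k ! * (ascPochhammer ℝ k).eval (1 / 2)) := by
  induction k with
  | zero => simp
  | succ k ih =>
    rw [show 2 * (k + 1) = 2 * k + 1 + 1 by ring, Nat.factorial_succ, Nat.factorial_succ,
      Nat.factorial_succ, ascPochhammer_succ_eval]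
    push_cast
    rw [ih]
    ring

theorem ascPochhammer_eval_nonneg {s : ℝ} (hs : 0 ≤ s) (k : ℕ) : 0 ≤ (ascPochhammer ℝ k).eval s := by
  induction k with
  | zero => simp
  | succ k ih =>
    rw [ascPochhammer_succ_eval]
    positivity

variable {E : Type*} [NormedAddCommGroup E] [InnerProductSpace ℝ E] [FiniteDimensional ℝ E]
  [MeasurableSpace E] [BorelSpace E]

theorem lintegral_sphere_inner_even_pow' {v : E} (hv : ‖v‖ = 1) (k : ℕ) :
    ∫⁻ ζ, ENNReal.ofReal (⟪v, (ζ : E)⟫ ^ (2 * k)) ∂surfaceMeasure E =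
      surfaceMeasure E univ * ENNReal.ofReal ((ascPochhammer ℝ k).eval (1 / 2) *
        ((ascPochhammer ℝ k).eval ((finrank ℝ E : ℝ) / 2))⁻¹) := by
  have hv0 : v ≠ 0 := by rintro rfl; simp at hv
  have : Nontrivial E := ⟨v, 0, hv0⟩
  have hn : (0 : ℝ) < finrank ℝ E := by exact_mod_cast finrank_pos
  have h0 := lintegral_sphere_inner_even_pow hv 0
  simp only [mul_zero, pow_zero, ENNReal.ofReal_one, lintegral_one, Nat.cast_zero, zero_add] at h0
  have hΓ : 0 < Real.Gamma ((finrank ℝ E : ℝ) / 2) := Real.Gamma_pos_of_pos (by positivity)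
  have hΓ' : 0 < Real.Gamma (1 / 2) := Real.Gamma_pos_of_pos (by positivity)
  have hA := ascPochhammer_pos k ((finrank ℝ E : ℝ) / 2) (by positivity)
  rw [lintegral_sphere_inner_even_pow hv, h0, ← ENNReal.ofReal_mul (by positivity),
    Real.Gamma_nat_add (by norm_num), Real.Gamma_nat_add (by positivity)]
  congr 1
  field_simp

/-- The average of a power of an affine function over the sphere as a hypergeometric function. -/
theorem lintegral_sphere_rpow_neg {v : E} (hv : ‖v‖ = 1) {s : ℝ} (hs : 0 ≤ s) {A B : ℝ}
    (hA : 0 < A) (hB : |B| < A) :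
    ∫⁻ ζ, ENNReal.ofReal ((A - B * ⟪v, (ζ : E)⟫) ^ (-s)) ∂surfaceMeasure E =
      surfaceMeasure E univ * ENNReal.ofReal
        (A ^ (-s) * ₂F₁ (s / 2) ((s + 1) / 2) ((finrank ℝ E : ℝ) / 2) (B ^ 2 / A ^ 2)) := by
  have hv0 : v ≠ 0 := by rintro rfl; simp at hv
  have : Nontrivial E := ⟨v, 0, hv0⟩
  have hn : (0 : ℝ) < finrank ℝ E := by exact_mod_cast finrank_pos
  set z : ℝ := B / A with hz
  have hz1 : |z| < 1 := by rwa [hz, abs_div, abs_of_pos hA, div_lt_one hA]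
  have hin : ∀ ζ : Metric.sphere (0 : E) 1, |z * ⟪v, (ζ : E)⟫| < 1 := fun ζ => by
    have h1 := abs_real_inner_le_norm v (ζ : E)
    rw [hv, norm_eq_of_mem_sphere, one_mul] at h1
    rw [abs_mul]
    exact (mul_le_of_le_one_right (abs_nonneg _) h1).trans_lt hz1
  set c : ℕ → ℝ := fun k => ((2 * k)! : ℝ)⁻¹ * (ascPochhammer ℝ (2 * k)).eval s with hc
  have hc0 : ∀ k, 0 ≤ c k := fun k =>
    mul_nonneg (by positivity) (ascPochhammer_eval_nonneg hs _)
  -- Odd powers average to zero on the sphere; adding the series at `y` and `-y` removes them and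
  -- leaves nonnegative terms, so the sum and `lintegral` may be exchanged freely.
  have heven : ∀ y : ℝ, |y| < 1 →
      HasSum (fun k => 2 * (c k * y ^ (2 * k))) ((1 - y) ^ (-s) + (1 + y) ^ (-s)) := by
    intro y hy
    have h1 := hasSum_one_sub_rpow_neg s hy
    have h2 := hasSum_one_sub_rpow_neg s (y := -y) (by rwa [abs_neg])
    rw [sub_neg_eq_add] at h2
    have h3 := h1.add h2
    have hinj : Function.Injective fun k : ℕ => 2 * k := fun a b h => by simpa using h
    rw [← hinj.hasSum_iff] at h3
    · refine h3.congr_fun fun k => ?_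
      simp only [Function.comp_apply, hc, (even_two_mul k).neg_pow]
      ring
    · intro k hk
      have hodd : Odd k := by
        rw [← Nat.not_even_iff_odd]
        rintro ⟨j, rfl⟩
        exact hk ⟨j, by simp; ring⟩
      rw [hodd.neg_pow]
      ring
  set ρ : ℕ → ℝ := fun k => (ascPochhammer ℝ k).eval (1 / 2) *
        ((ascPochhammer ℝ k).eval ((finrank ℝ E : ℝ) / 2))⁻¹ with hρ
  have hρ0 : ∀ k, 0 ≤ ρ k := fun k => mul_nonneg (ascPochhammer_eval_nonneg (by norm_num) _)
    (inv_nonneg.2 (ascPochhammer_eval_nonneg (by positivity) _))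
  have hσ0 : surfaceMeasure E univ ≠ 0 := by
    rw [Ne, Measure.measure_univ_eq_zero]; exact Measure.toSphere_ne_zero _
  have hσt : surfaceMeasure E univ ≠ ∞ := measure_ne_top _ _
  -- `ρ k` is the normalized moment of order `2 * k` of a coordinate bounded by `1`; this bound
  -- makes the hypergeometric series summable by comparison.
  have hρ1 : ∀ k, ρ k ≤ 1 := by
    intro k
    have h1 : ∫⁻ ζ, ENNReal.ofReal (⟪v, (ζ : E)⟫ ^ (2 * k)) ∂surfaceMeasure E ≤
        ∫⁻ _, 1 ∂surfaceMeasure E := by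
      refine lintegral_mono fun ζ => ?_
      have h1 := abs_real_inner_le_norm v (ζ : E)
      rw [hv, norm_eq_of_mem_sphere, one_mul] at h1
      rw [← (even_two_mul k).pow_abs]
      exact ENNReal.ofReal_le_one.2 (pow_le_one₀ (abs_nonneg _) h1)
    rw [lintegral_sphere_inner_even_pow' hv, lintegral_one] at h1
    have h2 := (ENNReal.mul_le_mul_iff_right hσ0 hσt).1 (h1.trans_eq (mul_one _).symm)
    exact ENNReal.ofReal_le_one.1 h2
  have hterm : ∀ k, ((k ! : ℝ)⁻¹ * (ascPochhammer ℝ k).eval (s / 2) *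
      (ascPochhammer ℝ k).eval ((s + 1) / 2) *
        ((ascPochhammer ℝ k).eval ((finrank ℝ E : ℝ) / 2))⁻¹) • (B ^ 2 / A ^ 2) ^ k =
      c k * z ^ (2 * k) * ρ k := by
    intro k
    have h1 := ascPochhammer_pos k ((finrank ℝ E : ℝ) / 2) (by positivity)
    have h2 := ascPochhammer_pos k (1 / 2 : ℝ) (by norm_num)
    simp only [hc, hρ, smul_eq_mul, ascPochhammer_eval_two_mul, factorial_two_mul_eq_ascPochhammer,
      ← div_pow, ← hz, pow_mul]
    field_simp
  have hsum : Summable fun k => c k * z ^ (2 * k) := by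
    have h := (heven z hz1).summable.mul_left 2⁻¹
    refine h.congr fun k => ?_
    ring
  have hnn : ∀ k, 0 ≤ c k * z ^ (2 * k) := fun k =>
    mul_nonneg (hc0 k) ((even_two_mul k).pow_nonneg z)
  have hsum' : Summable fun k => c k * z ^ (2 * k) * ρ k :=
    Summable.of_nonneg_of_le (fun k => mul_nonneg (hnn k) (hρ0 k))
      (fun k => mul_le_of_le_one_right (hnn k) (hρ1 k)) hsum
  have hF : ₂F₁ (s / 2) ((s + 1) / 2) ((finrank ℝ E : ℝ) / 2) (B ^ 2 / A ^ 2) =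
      ∑' k, c k * z ^ (2 * k) * ρ k := by
    rw [ordinaryHypergeometric_eq_tsum]
    exact tsum_congr hterm
  have hpos : ∀ ζ : Metric.sphere (0 : E) 1, 0 < 1 - z * ⟪v, (ζ : E)⟫ ∧ 0 < 1 + z * ⟪v, (ζ : E)⟫ :=
    fun ζ => by
      have := abs_lt.1 (hin ζ)
      constructor <;> linarith
  have hscale : ∀ ζ : Metric.sphere (0 : E) 1, ENNReal.ofReal ((A - B * ⟪v, (ζ : E)⟫) ^ (-s)) =
      ENNReal.ofReal (A ^ (-s)) * ENNReal.ofReal ((1 - z * ⟪v, (ζ : E)⟫) ^ (-s)) := fun ζ => by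
    rw [← ENNReal.ofReal_mul (by positivity), ← Real.mul_rpow hA.le (hpos ζ).1.le]
    congr 2
    rw [hz]
    field_simp
  have hsymm : ∫⁻ ζ, ENNReal.ofReal ((1 + z * ⟪v, (ζ : E)⟫) ^ (-s)) ∂surfaceMeasure E =
      ∫⁻ ζ, ENNReal.ofReal ((1 - z * ⟪v, (ζ : E)⟫) ^ (-s)) ∂surfaceMeasure E := by
    rw [← lintegral_sphere_neg (f := fun ζ => ENNReal.ofReal ((1 - z * ⟪v, ζ⟫) ^ (-s)))
      (by fun_prop)]
    simp only [inner_neg_right, mul_neg, sub_neg_eq_add]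
  have h2 : 2 * ∫⁻ ζ, ENNReal.ofReal ((1 - z * ⟪v, (ζ : E)⟫) ^ (-s)) ∂surfaceMeasure E =
      2 * (surfaceMeasure E univ * ENNReal.ofReal (∑' k, c k * z ^ (2 * k) * ρ k)) := by
    calc 2 * ∫⁻ ζ, ENNReal.ofReal ((1 - z * ⟪v, (ζ : E)⟫) ^ (-s)) ∂surfaceMeasure E
        = ∫⁻ ζ, (ENNReal.ofReal ((1 - z * ⟪v, (ζ : E)⟫) ^ (-s)) +
            ENNReal.ofReal ((1 + z * ⟪v, (ζ : E)⟫) ^ (-s))) ∂surfaceMeasure E := by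
          rw [lintegral_add_left (by fun_prop), hsymm, two_mul]
      _ = ∫⁻ ζ, ∑' k, ENNReal.ofReal (2 * (c k * z ^ (2 * k))) *
            ENNReal.ofReal (⟪v, (ζ : E)⟫ ^ (2 * k)) ∂surfaceMeasure E := by
          refine lintegral_congr fun ζ => ?_
          have h3 := heven _ (hin ζ)
          have h4 : ∀ k, 0 ≤ 2 * (c k * (z * ⟪v, (ζ : E)⟫) ^ (2 * k)) := fun k =>
            mul_nonneg two_pos.le (mul_nonneg (hc0 k) ((even_two_mul k).pow_nonneg _))
          rw [← ENNReal.ofReal_add (Real.rpow_nonneg (hpos ζ).1.le _)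
            (Real.rpow_nonneg (hpos ζ).2.le _), ← h3.tsum_eq,
            ENNReal.ofReal_tsum_of_nonneg h4 h3.summable]
          refine tsum_congr fun k => ?_
          rw [← ENNReal.ofReal_mul (mul_nonneg two_pos.le (hnn k)), mul_pow]
          congr 1
          ring
      _ = ∑' k, ENNReal.ofReal (2 * (c k * z ^ (2 * k))) *
            (surfaceMeasure E univ * ENNReal.ofReal (ρ k)) := by
          rw [lintegral_tsum fun k => by fun_prop]
          refine tsum_congr fun k => ?_
          rw [lintegral_const_mul _ (by fun_prop), lintegral_sphere_inner_even_pow' hv]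
      _ = _ := by
          rw [ENNReal.ofReal_tsum_of_nonneg (fun k => mul_nonneg (hnn k) (hρ0 k)) hsum',
            ← ENNReal.tsum_mul_left, ← ENNReal.tsum_mul_left]
          refine tsum_congr fun k => ?_
          rw [ENNReal.ofReal_mul two_pos.le, ENNReal.ofReal_mul (hnn k)]
          simp only [ENNReal.ofReal_ofNat]
          ring
  have h3 := (ENNReal.mul_right_inj two_ne_zero ENNReal.ofNat_ne_top).1 h2
  simp only [hscale]
  rw [lintegral_const_mul _ (by fun_prop), h3, hF, ENNReal.ofReal_mul (by positivity)]
  ring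

end HypergeometricAverage

/-! ### Evaluation of the `L¹` norm of the differentiated kernel. -/

section GradientKernel

open scoped ENNReal

variable {E : Type*} [NormedAddCommGroup E] [InnerProductSpace ℝ E]

theorem fderiv_poissonKernelBall_apply {x ζ : E} (h : x ≠ ζ) (l : E) :
    fderiv ℝ (fun y => poissonKernelBall y ζ) x l =
      -(2 * ⟪x, l⟫ + finrank ℝ E * (1 - ‖x‖ ^ 2) * ⟪x - ζ, l⟫ / ‖x - ζ‖ ^ 2) /
        ‖x - ζ‖ ^ finrank ℝ E := by
  have hw : 0 < ‖x - ζ‖ := norm_pos_iff.2 (sub_ne_zero.2 h)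
  have h0 : (‖x - ζ‖ ^ 2) ^ (-((finrank ℝ E : ℝ) / 2)) = (‖x - ζ‖ ^ finrank ℝ E)⁻¹ := by
    rw [Real.rpow_neg (by positivity), ← Real.rpow_natCast ‖x - ζ‖ 2,
      ← Real.rpow_natCast ‖x - ζ‖ (finrank ℝ E), ← Real.rpow_mul (norm_nonneg _)]
    congr 2
    push_cast
    ring
  rw [(hasFDerivAt_poissonKernelBall h).fderiv, Real.rpow_sub_one (by positivity), h0]
  simp only [sub_apply, smul_apply, innerSL_apply_apply, smul_eq_mul]
  field_simp
  ring

/-- At the reflected point `⟪x - ζ*, l⟫ / ‖x - ζ*‖² = -⟪x - ζ, l⟫ / (1 - ‖x‖²)`, so the quotient in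
the derivative becomes affine in `ζ`. The Jacobian lowers the remaining power of the distance to `‖x
- ζ‖ ^ (2 - n)`. -/
theorem fderiv_poissonKernelBall_chordReflection {x ζ : E} (hx : ‖x‖ < 1) (hζ : ‖ζ‖ = 1)
    (hn : 2 ≤ finrank ℝ E) (l : E) :
    ((1 - ‖x‖ ^ 2) / ‖x - ζ‖ ^ 2) ^ (finrank ℝ E - 1) *
      |fderiv ℝ (fun y => poissonKernelBall y (chordReflection x ζ)) x l| =
      finrank ℝ E / (1 - ‖x‖ ^ 2) *
        (|((finrank ℝ E : ℝ) - 2) / finrank ℝ E * ⟪x, l⟫ - ⟪ζ, l⟫| *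
          (1 + ‖x‖ ^ 2 - 2 * ⟪x, ζ⟫) ^ (-((finrank ℝ E : ℝ) / 2 - 1))) := by
  have hw : 0 < ‖x - ζ‖ := by
    rw [norm_sub_rev]; exact norm_pos_iff.2 (sub_ne_zero_of_norm hx hζ)
  have hx' : 0 < 1 - ‖x‖ ^ 2 := by nlinarith [norm_nonneg x]
  have hne : x ≠ chordReflection x ζ := fun h => by
    have := norm_chordReflection hx hζ
    rw [← h] at this
    exact hx.ne this
  obtain ⟨m, hm⟩ : ∃ m, finrank ℝ E = m + 2 := ⟨_, (Nat.sub_add_cancel hn).symm⟩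
  have hpow : (1 + ‖x‖ ^ 2 - 2 * ⟪x, ζ⟫) ^ (-((finrank ℝ E : ℝ) / 2 - 1)) = (‖x - ζ‖ ^ m)⁻¹ := by
    rw [← norm_sub_sphere_sq hζ, Real.rpow_neg (by positivity), ← Real.rpow_natCast ‖x - ζ‖ 2,
      ← Real.rpow_natCast ‖x - ζ‖ m, ← Real.rpow_mul (norm_nonneg _), hm]
    congr 2
    push_cast
    ring
  have hfd : fderiv ℝ (fun y => poissonKernelBall y (chordReflection x ζ)) x l =
      (‖x - ζ‖ / (1 - ‖x‖ ^ 2)) ^ finrank ℝ E * finrank ℝ E *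
        (((finrank ℝ E : ℝ) - 2) / finrank ℝ E * ⟪x, l⟫ - ⟪ζ, l⟫) := by
    rw [fderiv_poissonKernelBall_apply hne, norm_sub_chordReflection hx hζ, sub_chordReflection,
      inner_smul_left, inner_sub_left]
    have : (finrank ℝ E : ℝ) ≠ 0 := by rw [hm]; positivity
    simp only [conj_trivial]
    generalize 1 - ‖x‖ ^ 2 = N at hx'
    have hNn : N ^ finrank ℝ E ≠ 0 := pow_ne_zero _ hx'.ne'
    simp only [div_pow]
    generalize N ^ finrank ℝ E = M at hNn
    field_simp
    ring
  rw [hfd, hpow, abs_mul, abs_mul, abs_of_pos (pow_pos (div_pos hw hx') _), Nat.abs_cast, hm,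
    show m + 2 - 1 = m + 1 by omega]
  generalize |((m + 2 : ℕ) - 2 : ℝ) / (m + 2 : ℕ) * ⟪x, l⟫ - ⟪ζ, l⟫| = c
  rw [div_pow, div_pow, ← pow_mul]
  field_simp
  ring

variable [FiniteDimensional ℝ E] [MeasurableSpace E] [BorelSpace E]

theorem lintegral_abs_fderiv_poissonKernelBall {x : E} (hx : ‖x‖ < 1) (hn : 2 ≤ finrank ℝ E)
    (l : E) :
    ∫⁻ ζ, ENNReal.ofReal |fderiv ℝ (fun y => poissonKernelBall y (ζ : E)) x l| ∂surfaceMeasure E =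
      ENNReal.ofReal (finrank ℝ E / (1 - ‖x‖ ^ 2)) * ∫⁻ ζ, ENNReal.ofReal
        (|((finrank ℝ E : ℝ) - 2) / finrank ℝ E * ⟪x, l⟫ - ⟪(ζ : E), l⟫| *
          (1 + ‖x‖ ^ 2 - 2 * ⟪x, (ζ : E)⟫) ^ (-((finrank ℝ E : ℝ) / 2 - 1))) ∂surfaceMeasure E := by
  have : Nontrivial E := Module.nontrivial_of_finrank_pos (R := ℝ) (by omega)
  have hx' : 0 < 1 - ‖x‖ ^ 2 := by nlinarith [norm_nonneg x]
  -- The change of variables asks for a function measurable on all of `E`; this closed formula is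
  -- one, and it agrees with the derivative on the sphere.
  set D : E → ℝ := fun ζ => -(2 * ⟪x, l⟫ + finrank ℝ E * (1 - ‖x‖ ^ 2) * ⟪x - ζ, l⟫ / ‖x - ζ‖ ^ 2) /
        ‖x - ζ‖ ^ finrank ℝ E with hD
  have hDm : Measurable D := by fun_prop
  have hne : ∀ ζ : E, ‖ζ‖ = 1 → x ≠ ζ := fun ζ hζ h => by
    rw [h] at hx
    exact hx.ne hζ
  have h1 : ∀ ζ : Metric.sphere (0 : E) 1,
      ENNReal.ofReal |fderiv ℝ (fun y => poissonKernelBall y (ζ : E)) x l| =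
        ENNReal.ofReal |D ζ| := fun ζ => by
    rw [fderiv_poissonKernelBall_apply (hne _ (norm_eq_of_mem_sphere ζ))]
  simp only [h1]
  rw [lintegral_sphere_chordReflection hx (g := fun ζ => ENNReal.ofReal |D ζ|) (by fun_prop),
    ← lintegral_const_mul _ (by fun_prop)]
  refine lintegral_congr fun ζ => ?_
  have hζ : ‖(ζ : E)‖ = 1 := norm_eq_of_mem_sphere ζ
  rw [← ENNReal.ofReal_mul (by positivity), ← ENNReal.ofReal_mul (by positivity),
    ← fderiv_poissonKernelBall_chordReflection hx hζ hn,
    fderiv_poissonKernelBall_apply (hne _ (norm_chordReflection hx hζ))]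

/-- Cauchy–Schwarz in the plane; it is the condition `|B| < A` under which the slice average is
hypergeometric. -/
theorem two_mul_abs_lt_of_sq_add_sq_lt_one {a b : ℝ} (h : a ^ 2 + b ^ 2 < 1) (φ : ℝ) :
    |2 * b * Real.sin φ| < 1 + (a ^ 2 + b ^ 2) - 2 * a * Real.cos φ := by
  have h1 := Real.sin_sq_add_cos_sq φ
  have key : ∀ β : ℝ, β ^ 2 = b ^ 2 →
      2 * (a * Real.cos φ + β * Real.sin φ) < 1 + (a ^ 2 + b ^ 2) := by
    intro β hβ
    have h2 : (a * Real.cos φ + β * Real.sin φ) ^ 2 ≤ a ^ 2 + b ^ 2 := by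
      have h3 : a ^ 2 + b ^ 2 - (a * Real.cos φ + β * Real.sin φ) ^ 2 =
          (a * Real.sin φ - β * Real.cos φ) ^ 2 := by
        rw [← hβ]
        linear_combination (-(a ^ 2 + β ^ 2)) * h1
      nlinarith [sq_nonneg (a * Real.sin φ - β * Real.cos φ)]
    refine (abs_lt.1 (abs_lt_of_sq_lt_sq ?_ (by positivity))).2
    nlinarith [mul_pos (sub_pos.2 h) (sub_pos.2 h)]
  rw [abs_lt]
  constructor
  · linarith [key (-b) (by ring)]
  · linarith [key b rfl]

theorem lintegral_comp_cos (g : ℝ → ℝ≥0∞) :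
    ∫⁻ t in Ioo (-1 : ℝ) 1, g t = ∫⁻ φ in Ioo 0 Real.pi, ENNReal.ofReal (Real.sin φ) * g (Real.cos φ) := by
  have hinj : InjOn Real.cos (Ioo 0 Real.pi) := Real.injOn_cos.mono Ioo_subset_Icc_self
  have himg : Real.cos '' Ioo 0 Real.pi = Ioo (-1) 1 := by
    ext t
    constructor
    · rintro ⟨φ, hφ, rfl⟩
      have h1 := Real.strictAntiOn_cos ⟨le_rfl, Real.pi_pos.le⟩ (Ioo_subset_Icc_self hφ) hφ.1
      have h2 := Real.strictAntiOn_cos (Ioo_subset_Icc_self hφ) ⟨Real.pi_pos.le, le_rfl⟩ hφ.2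
      rw [Real.cos_zero] at h1
      rw [Real.cos_pi] at h2
      exact ⟨h2, h1⟩
    · intro ht
      refine ⟨Real.arccos t, ⟨Real.arccos_pos.2 ht.2, ?_⟩, Real.cos_arccos ht.1.le ht.2.le⟩
      exact lt_of_le_of_ne (Real.arccos_le_pi t) fun h => by
        rw [Real.arccos_eq_pi] at h
        linarith [ht.1]
  have h := lintegral_image_eq_lintegral_abs_deriv_mul measurableSet_Ioo
    (fun φ _ => (Real.hasDerivAt_cos φ).hasDerivWithinAt) hinj g
  rw [himg] at h
  rw [h]
  refine setLIntegral_congr_fun measurableSet_Ioo fun φ hφ => ?_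
  simp only [abs_neg]
  rw [abs_of_pos (Real.sin_pos_of_pos_of_lt_pi hφ.1 hφ.2)]

/-- Reduction of the gradient kernel integral to one dimension. -/
theorem lintegral_sphere_abs_mul_rpow {l : E} (hl : ‖l‖ = 1) (hn : 2 ≤ finrank ℝ E)
    {v : (ℝ ∙ l)ᗮ} (hv : ‖v‖ = 1) {a b : ℝ} (hab : a ^ 2 + b ^ 2 < 1) (c : ℝ) :
    ∫⁻ ζ, ENNReal.ofReal (|c - ⟪(ζ : E), l⟫| * (1 + (a ^ 2 + b ^ 2) -
        2 * ⟪a • l + b • (v : E), (ζ : E)⟫) ^ (-((finrank ℝ E : ℝ) / 2 - 1))) ∂surfaceMeasure E =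
      surfaceMeasure (ℝ ∙ l)ᗮ univ * ∫⁻ t in Ioo (-1 : ℝ) 1, ENNReal.ofReal
        (|c - t| * ((1 - t ^ 2) ^ (((finrank ℝ E : ℝ) - 3) / 2) /
          (1 + (a ^ 2 + b ^ 2) - 2 * a * t) ^ ((finrank ℝ E : ℝ) / 2 - 1)) *
        ₂F₁ (((finrank ℝ E : ℝ) - 2) / 4) ((finrank ℝ E : ℝ) / 4) (((finrank ℝ E : ℝ) - 1) / 2)
          (4 * b ^ 2 * (1 - t ^ 2) / (1 + (a ^ 2 + b ^ 2) - 2 * a * t) ^ 2)) := by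
  have hl0 : l ≠ 0 := by rintro rfl; simp at hl
  have hd : finrank ℝ (ℝ ∙ l)ᗮ = finrank ℝ E - 1 := by
    have h2 := (ℝ ∙ l).finrank_add_finrank_orthogonal
    rw [finrank_span_singleton hl0] at h2
    omega
  obtain ⟨m, hm⟩ : ∃ m, finrank ℝ E = m + 2 := ⟨_, (Nat.sub_add_cancel hn).symm⟩
  have hd' : (finrank ℝ (ℝ ∙ l)ᗮ : ℝ) = m + 1 := by rw [hd, hm]; push_cast; ring
  have hll : ⟪l, l⟫ = 1 := by rw [real_inner_self_eq_norm_sq, hl]; norm_num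
  have horth : ∀ z : (ℝ ∙ l)ᗮ, ⟪l, (z : E)⟫ = 0 := fun z =>
    Submodule.mem_orthogonal_singleton_iff_inner_right.1 z.2
  rw [lintegral_sphere_eq_lintegral_slices hl hn (f := fun ζ => ENNReal.ofReal (|c - ⟪ζ, l⟫| *
    (1 + (a ^ 2 + b ^ 2) - 2 * ⟪a • l + b • (v : E), ζ⟫) ^ (-((finrank ℝ E : ℝ) / 2 - 1))))
    (by fun_prop), lintegral_lintegral_swap (by fun_prop), lintegral_comp_cos,
    ← lintegral_const_mul' _ _ (measure_ne_top _ _)]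
  refine setLIntegral_congr_fun measurableSet_Ioo fun φ hφ => ?_
  have hs : 0 < Real.sin φ := Real.sin_pos_of_pos_of_lt_pi hφ.1 hφ.2
  have hlt := two_mul_abs_lt_of_sq_add_sq_lt_one hab φ
  set A : ℝ := 1 + (a ^ 2 + b ^ 2) - 2 * a * Real.cos φ with hA
  have hApos : 0 < A := (abs_nonneg _).trans_lt hlt
  have hin1 : ∀ ω : (ℝ ∙ l)ᗮ, ⟪Real.cos φ • l + Real.sin φ • (ω : E), l⟫ = Real.cos φ := fun ω => by
    rw [inner_add_left, inner_smul_left, inner_smul_left, real_inner_comm l (ω : E), horth, hll]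
    simp
  have hin2 : ∀ ω : (ℝ ∙ l)ᗮ, 1 + (a ^ 2 + b ^ 2) -
      2 * ⟪a • l + b • (v : E), Real.cos φ • l + Real.sin φ • (ω : E)⟫ =
      A - 2 * b * Real.sin φ * ⟪v, ω⟫ := fun ω => by
    simp only [inner_add_left, inner_add_right, inner_smul_left, inner_smul_right, horth,
      real_inner_comm l (v : E), hll, conj_trivial, Submodule.coe_inner, hA]
    ring
  simp only [hin1, hin2]
  have hconv : ∀ ω : Metric.sphere (0 : (ℝ ∙ l)ᗮ) 1, ENNReal.ofReal (Real.sin φ ^ (finrank ℝ E - 2)) *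
      ENNReal.ofReal (|c - Real.cos φ| * (A - 2 * b * Real.sin φ * ⟪v, (ω : (ℝ ∙ l)ᗮ)⟫) ^
        (-((finrank ℝ E : ℝ) / 2 - 1))) =
      ENNReal.ofReal (Real.sin φ ^ (finrank ℝ E - 2) * |c - Real.cos φ|) *
        ENNReal.ofReal ((A - 2 * b * Real.sin φ * ⟪v, (ω : (ℝ ∙ l)ᗮ)⟫) ^ (-((m : ℝ) / 2))) :=
    fun ω => by
    rw [← ENNReal.ofReal_mul (by positivity), ← ENNReal.ofReal_mul (by positivity), hm,
      show (((m + 2 : ℕ) : ℝ) / 2 - 1) = (m : ℝ) / 2 by push_cast; ring, ← mul_assoc]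
  simp only [hconv]
  -- The slice average, with exponent `s = m / 2 = n / 2 - 1` on the unit sphere of the `(n -
  -- 1)`-dimensional complement; `s = 0` when `n = 2`.
  rw [lintegral_const_mul _ (by fun_prop), lintegral_sphere_rpow_neg hv (by positivity) hApos hlt,
    hd', hm, ← mul_assoc, mul_comm (ENNReal.ofReal _) (surfaceMeasure _ _), mul_assoc,
    ← ENNReal.ofReal_mul (by positivity), ← ENNReal.ofReal_mul hs.le]
  congr 2
  have hcos : 1 - Real.cos φ ^ 2 = Real.sin φ ^ 2 := by
    rw [Real.sin_sq]
  -- The substitution `t = cos φ` absorbs one factor `sin φ`, whence the exponent `(n - 3) / 2`,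
  -- which is negative for `n = 2`.
  have hsin : (Real.sin φ ^ 2) ^ ((((m + 2 : ℕ) : ℝ) - 3) / 2) = Real.sin φ ^ m / Real.sin φ := by
    rw [← Real.rpow_natCast _ 2, ← Real.rpow_mul hs.le, ← Real.rpow_natCast _ m,
      ← Real.rpow_sub_one hs.ne']
    congr 1
    push_cast
    ring
  rw [hcos, hsin, Real.rpow_neg hApos.le,
    show (((m + 2 : ℕ) : ℝ) / 2 - 1) = (m : ℝ) / 2 by push_cast; ring,
    show (((m + 2 : ℕ) : ℝ) - 2) / 4 = (m : ℝ) / 2 / 2 by push_cast; ring,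
    show ((m + 2 : ℕ) : ℝ) / 4 = ((m : ℝ) / 2 + 1) / 2 by push_cast; ring,
    show (((m + 2 : ℕ) : ℝ) - 1) / 2 = ((m : ℝ) + 1) / 2 by push_cast; ring,
    show 4 * b ^ 2 * Real.sin φ ^ 2 / A ^ 2 = (2 * b * Real.sin φ) ^ 2 / A ^ 2 by ring,
    Nat.add_sub_cancel]
  field_simp

/-- No convergence condition is needed: a divergent `tsum` is zero. -/
theorem ordinaryHypergeometric_nonneg {a b c x : ℝ} (ha : 0 ≤ a) (hb : 0 ≤ b) (hc : 0 ≤ c)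
    (hx : 0 ≤ x) : 0 ≤ ₂F₁ a b c x := by
  rw [ordinaryHypergeometric_eq_tsum]
  refine tsum_nonneg fun k => ?_
  have h1 := ascPochhammer_eval_nonneg ha k
  have h2 := ascPochhammer_eval_nonneg hb k
  have h3 := ascPochhammer_eval_nonneg hc k
  rw [smul_eq_mul]
  positivity

theorem measurable_ordinaryHypergeometric (a b c : ℝ) : Measurable (₂F₁ a b c : ℝ → ℝ) := by
  rw [ordinaryHypergeometric_eq_tsum]
  exact Measurable.tsum fun k => by fun_prop

theorem surfaceMeasure_real_univ [Nontrivial E] : (surfaceMeasure E).real univ =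
    2 * Real.pi ^ ((finrank ℝ E : ℝ) / 2) / Real.Gamma ((finrank ℝ E : ℝ) / 2) := by
  have : 0 < Real.Gamma ((finrank ℝ E : ℝ) / 2) := Real.Gamma_pos_of_pos (by
    have : (0 : ℝ) < finrank ℝ E := by exact_mod_cast finrank_pos
    positivity)
  rw [measureReal_def, surfaceMeasure_univ, ENNReal.toReal_ofReal (by positivity)]

/-- The sharp gradient constant of the unit ball as a one-dimensional integral. -/
theorem integral_abs_fderiv_poissonKernelBall {l : E} (hl : ‖l‖ = 1) (hn : 2 ≤ finrank ℝ E)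
    {v : (ℝ ∙ l)ᗮ} (hv : ‖v‖ = 1) {a b : ℝ} (hab : a ^ 2 + b ^ 2 < 1) :
    ((surfaceMeasure E).real univ)⁻¹ * ∫ ζ, |fderiv ℝ (fun y => poissonKernelBall y (ζ : E))
        (a • l + b • (v : E)) l| ∂surfaceMeasure E =
      finrank ℝ E / (1 - (a ^ 2 + b ^ 2)) * (Real.Gamma ((finrank ℝ E : ℝ) / 2) /
        (Real.Gamma (1 / 2) * Real.Gamma (((finrank ℝ E : ℝ) - 1) / 2))) *
      ∫ t in (-1 : ℝ)..1, |((finrank ℝ E : ℝ) - 2) / finrank ℝ E * a - t| *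
        ((1 - t ^ 2) ^ (((finrank ℝ E : ℝ) - 3) / 2) /
          (1 + (a ^ 2 + b ^ 2) - 2 * a * t) ^ ((finrank ℝ E : ℝ) / 2 - 1)) *
        ₂F₁ (((finrank ℝ E : ℝ) - 2) / 4) ((finrank ℝ E : ℝ) / 4) (((finrank ℝ E : ℝ) - 1) / 2)
          (4 * b ^ 2 * (1 - t ^ 2) / (1 + (a ^ 2 + b ^ 2) - 2 * a * t) ^ 2) := by
  have hl0 : l ≠ 0 := by rintro rfl; simp at hl
  have : Nontrivial E := ⟨l, 0, hl0⟩
  have hd : finrank ℝ (ℝ ∙ l)ᗮ = finrank ℝ E - 1 := by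
    have h2 := (ℝ ∙ l).finrank_add_finrank_orthogonal
    rw [finrank_span_singleton hl0] at h2
    omega
  have : Nontrivial (ℝ ∙ l)ᗮ := Module.nontrivial_of_finrank_pos (R := ℝ) (by omega)
  have hnR : (2 : ℝ) ≤ finrank ℝ E := by exact_mod_cast hn
  set x : E := a • l + b • (v : E) with hxdef
  have hx2 : ‖x‖ ^ 2 = a ^ 2 + b ^ 2 := by
    have := norm_smul_add_orthogonal_sq hl a (b • v)
    rw [norm_smul, hv] at this
    simpa using this
  have hx : ‖x‖ < 1 := by
    rw [← sq_lt_one_iff₀ (norm_nonneg _), hx2]; exact hab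
  have hxl : ⟪x, l⟫ = a := by
    have h : ⟪(v : E), l⟫ = 0 := Submodule.mem_orthogonal_singleton_iff_inner_left.1 v.2
    rw [hxdef, inner_add_left, inner_smul_left, inner_smul_left, h, real_inner_self_eq_norm_sq, hl]
    simp
  set h : ℝ → ℝ := fun t => |((finrank ℝ E : ℝ) - 2) / finrank ℝ E * a - t| *
        ((1 - t ^ 2) ^ (((finrank ℝ E : ℝ) - 3) / 2) /
          (1 + (a ^ 2 + b ^ 2) - 2 * a * t) ^ ((finrank ℝ E : ℝ) / 2 - 1)) *
        ₂F₁ (((finrank ℝ E : ℝ) - 2) / 4) ((finrank ℝ E : ℝ) / 4) (((finrank ℝ E : ℝ) - 1) / 2)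
          (4 * b ^ 2 * (1 - t ^ 2) / (1 + (a ^ 2 + b ^ 2) - 2 * a * t) ^ 2) with hh
  have hhm : Measurable h := by
    have := measurable_ordinaryHypergeometric (((finrank ℝ E : ℝ) - 2) / 4) ((finrank ℝ E : ℝ) / 4)
      (((finrank ℝ E : ℝ) - 1) / 2)
    fun_prop
  have hh0 : ∀ t ∈ Ioo (-1 : ℝ) 1, 0 ≤ h t := by
    intro t ht
    have h1 : 0 < 1 - t ^ 2 := by nlinarith [ht.1, ht.2]
    have h2 := (abs_nonneg _).trans_lt (two_mul_abs_lt_of_sq_add_sq_lt_one hab (Real.arccos t))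
    rw [Real.cos_arccos ht.1.le ht.2.le] at h2
    refine mul_nonneg (by positivity) (ordinaryHypergeometric_nonneg ?_ ?_ ?_ (by positivity))
    all_goals linarith
  have hD : Integrable (fun ζ : Metric.sphere (0 : E) 1 => fderiv ℝ (fun y => poissonKernelBall y (ζ : E)) x l)
      (surfaceMeasure E) := by
    simpa using integrable_fderiv_poissonKernelBall (f := fun _ => 1) measurable_const (M := 1)
      (by simp) hx l
  have hσ := surfaceMeasure_real_univ_pos (E := E)
  have hI : ∫ ζ, |fderiv ℝ (fun y => poissonKernelBall y (ζ : E)) x l| ∂surfaceMeasure E =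
      finrank ℝ E / (1 - (a ^ 2 + b ^ 2)) * ((surfaceMeasure (ℝ ∙ l)ᗮ).real univ *
        ∫ t in Ioo (-1 : ℝ) 1, h t) := by
    have hhi : ∫ t in Ioo (-1 : ℝ) 1, h t = (∫⁻ t in Ioo (-1 : ℝ) 1, ENNReal.ofReal (h t)).toReal :=
      integral_eq_lintegral_of_nonneg_ae
        ((ae_restrict_mem measurableSet_Ioo).mono hh0) hhm.aestronglyMeasurable
    rw [integral_eq_lintegral_of_nonneg_ae (Eventually.of_forall fun ζ => abs_nonneg _)
      hD.abs.aestronglyMeasurable, lintegral_abs_fderiv_poissonKernelBall hx hn, hx2, hxl,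
      lintegral_sphere_abs_mul_rpow hl hn hv hab, ENNReal.toReal_mul, ENNReal.toReal_mul,
      ENNReal.toReal_ofReal (div_nonneg (by positivity) (by linarith)), hhi]
    rfl
  have hΓ1 : 0 < Real.Gamma ((finrank ℝ E : ℝ) / 2) := Real.Gamma_pos_of_pos (by positivity)
  have hΓ2 : 0 < Real.Gamma (((finrank ℝ E : ℝ) - 1) / 2) :=
    Real.Gamma_pos_of_pos (by linarith)
  have hd' : (finrank ℝ (ℝ ∙ l)ᗮ : ℝ) = finrank ℝ E - 1 := by
    rw [hd, Nat.cast_sub (by omega), Nat.cast_one]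
  -- Area of the slice sphere over area of the full sphere; the leftover `√π` is `Γ(1 / 2)`.
  have hratio : ((surfaceMeasure E).real univ)⁻¹ * (surfaceMeasure (ℝ ∙ l)ᗮ).real univ =
      Real.Gamma ((finrank ℝ E : ℝ) / 2) /
        (Real.Gamma (1 / 2) * Real.Gamma (((finrank ℝ E : ℝ) - 1) / 2)) := by
    rw [surfaceMeasure_real_univ, surfaceMeasure_real_univ, hd', Real.Gamma_one_half_eq,
      Real.sqrt_eq_rpow, show (finrank ℝ E : ℝ) / 2 = ((finrank ℝ E : ℝ) - 1) / 2 + 1 / 2 by ring,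
      Real.rpow_add Real.pi_pos]
    have := Real.rpow_pos_of_pos Real.pi_pos (((finrank ℝ E : ℝ) - 1) / 2)
    have := Real.rpow_pos_of_pos Real.pi_pos (1 / 2)
    rw [show (finrank ℝ E : ℝ) / 2 = ((finrank ℝ E : ℝ) - 1) / 2 + 1 / 2 by ring] at hΓ1
    field_simp
  rw [hI, ← hratio, intervalIntegral.integral_of_le (by norm_num), integral_Ioc_eq_integral_Ioo]
  ring

end GradientKernel

/-! ### Specialization to a point on the first axis. -/

theorem theorem1 (n : ℕ) (hn : 2 ≤ n) (ρ : ℝ) (hρ0 : 0 ≤ ρ) (hρ1 : ρ < 1) (α : ℝ)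
    (e₁ e₂ l : EuclideanSpace ℝ (Fin n))
    (he₁ : e₁ = EuclideanSpace.single (⟨0, by omega⟩ : Fin n) (1 : ℝ))
    (he₂ : e₂ = EuclideanSpace.single (⟨1, by omega⟩ : Fin n) (1 : ℝ))
    (hl : l = Real.cos α • e₁ + Real.sin α • e₂) :
    IsSharpConstant (ρ • e₁) l
      ((n : ℝ) / (1 - ρ ^ 2) *
        (Real.Gamma ((n : ℝ) / 2) / (Real.Gamma (1 / 2) * Real.Gamma (((n : ℝ) - 1) / 2))) *
        ∫ x in (-1 : ℝ)..1,
          |((n : ℝ) - 2) / (n : ℝ) * ρ * Real.cos α - x| *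
            ((1 - x ^ 2) ^ (((n : ℝ) - 3) / 2) /
              (1 + ρ ^ 2 - 2 * ρ * x * Real.cos α) ^ ((n : ℝ) / 2 - 1)) *
            ₂F₁ (((n : ℝ) - 2) / 4) ((n : ℝ) / 4) (((n : ℝ) - 1) / 2)
              (4 * ρ ^ 2 * Real.sin α ^ 2 * (1 - x ^ 2) /
                (1 + ρ ^ 2 - 2 * ρ * x * Real.cos α) ^ 2)) := by
  have : NeZero n := ⟨by omega⟩
  have hcs := Real.sin_sq_add_cos_sq α
  have h11 : ⟪e₁, e₁⟫ = 1 := by simp [he₁]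
  have h22 : ⟪e₂, e₂⟫ = 1 := by simp [he₂]
  have h12 : ⟪e₁, e₂⟫ = 0 := by
    rw [he₁, he₂, EuclideanSpace.inner_single_left]
    simp
  have h21 : ⟪e₂, e₁⟫ = 0 := by rw [real_inner_comm, h12]
  have hl1 : ‖l‖ = 1 := by
    rw [← sq_eq_sq₀ (norm_nonneg _) zero_le_one, ← real_inner_self_eq_norm_sq, hl]
    simp only [inner_add_left, inner_add_right, inner_smul_left, inner_smul_right, h11, h12, h21,
      h22, conj_trivial]
    linear_combination hcs
  have hv0 : ⟪l, Real.sin α • e₁ - Real.cos α • e₂⟫ = 0 := by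
    rw [hl]
    simp only [inner_add_left, inner_sub_right, inner_smul_left, inner_smul_right, h11, h12, h21,
      h22, conj_trivial]
    ring
  -- The unit vector of the plane of `e₁`, `e₂` orthogonal to `l`, with the sign for which `e₁ = cos
  -- α • l + sin α • v`; hence `a = ρ cos α` and `b = ρ sin α`.
  let v : (ℝ ∙ l)ᗮ := ⟨Real.sin α • e₁ - Real.cos α • e₂,
    Submodule.mem_orthogonal_singleton_iff_inner_right.2 hv0⟩
  have hv1 : ‖v‖ = 1 := by
    change ‖Real.sin α • e₁ - Real.cos α • e₂‖ = 1
    rw [← sq_eq_sq₀ (norm_nonneg _) zero_le_one, ← real_inner_self_eq_norm_sq]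
    simp only [inner_sub_left, inner_sub_right, inner_smul_left, inner_smul_right, h11, h12,
      h21, h22, conj_trivial]
    linear_combination hcs
  have hx : ρ • e₁ = (ρ * Real.cos α) • l + (ρ * Real.sin α) • (v : EuclideanSpace ℝ (Fin n)) := by
    have : e₁ = (Real.sin α ^ 2 + Real.cos α ^ 2) • e₁ := by rw [hcs, one_smul]
    have hvc : (v : EuclideanSpace ℝ (Fin n)) = Real.sin α • e₁ - Real.cos α • e₂ := rfl
    rw [hvc]
    conv_rhs => rw [hl]
    conv_lhs => rw [this]
    module
  have hab : (ρ * Real.cos α) ^ 2 + (ρ * Real.sin α) ^ 2 = ρ ^ 2 := by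
    linear_combination ρ ^ 2 * hcs
  have hab1 : (ρ * Real.cos α) ^ 2 + (ρ * Real.sin α) ^ 2 < 1 := by
    rw [hab]; nlinarith
  have hρ : ‖ρ • e₁‖ < 1 := by
    rw [norm_smul, Real.norm_eq_abs, abs_of_nonneg hρ0, he₁]
    simpa using hρ1
  have key := integral_abs_fderiv_poissonKernelBall hl1 (by simpa using hn) hv1 hab1
  have hsharp := isSharpConstant_poissonKernelBall hρ l
  rw [← hx, hab] at key
  rw [key] at hsharp
  simp only [finrank_euclideanSpace, Fintype.card_fin] at hsharp
  have h1 : ((n : ℝ) - 2) / n * (ρ * Real.cos α) = ((n : ℝ) - 2) / n * ρ * Real.cos α := by ring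
  have h2 (x : ℝ) : 2 * (ρ * Real.cos α) * x = 2 * ρ * x * Real.cos α := by ring
  have h3 : 4 * (ρ * Real.sin α) ^ 2 = 4 * ρ ^ 2 * Real.sin α ^ 2 := by ring
  simp only [h1, h2, h3] at hsharp
  exact hsharp
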